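/- **Setting.** A rank-one clause on $n$ qubits consists of $\ell\ge 1$ distinct qubits (its locality is $\ell$) and a unit vector $|c\rangle\in(\mathbb C^2)^{\otimes \ell}$ on them; it stands for the projector $\Pi_c=|c\rangle\langle c|\otimes I$ on $(\mathbb C^2)^{\otimes n}$. An instance of $k$-QSAT here is a finite family of rank-one clauses on $n$ qubits, each of locality between $1$ and $k$; several clauses may act on the same qubits. It is satisfiable if some unit vector $|\psi\rangle\in(\mathbb C^2)^{\otimes n}$, possibly entangled, has $\Pi_c|\psi\rangle=0$ for all clauses $c$. The input lists $n$, the number $m$ of clauses, and, for each clause, its locality, its qubits and its $2^\ell$ complex amplitudes; its length is $n+m+\sum_c(\ell_c+2^{\ell_c})$. The model of computation is the random access machine over $\mathbb C$: programs are finite and work on arrays of complex numbers, with operations $+,-,\times,/$, complex conjugation, principal square root and zero test, and on arrays of natural numbers, with literals, $+$, truncated $-$, comparison and indirect addressing; each operation costs one step, numbers are exact, and the only complex constants are $0$ and $1$. **Theorem.** There are one such program $A$ and one polynomial $p$ such that for all $k$ and $n$ and every instance $\Pi$ of $k$-QSAT on $n$ qubits, with rank-one clauses of locality from $1$ to $k$,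 in which every qubit occurs in at most two clauses, $A$ halts on $\Pi$ within $p(N)$ steps, where $N$ is the length of the input, and * if $\Pi$ is satisfiable, then $A$ accepts and outputs unit vectors $|\phi_1\rangle,\dots,|\phi_n\rangle\in\mathbb C^2$ such that the product state $|\phi_1\rangle\otimes\cdots\otimes|\phi_n\rangle$ satisfies $\Pi$; * if $\Pi$ is not satisfiable, then $A$ rejects. -/

import Mathlib

noncomputable section

namespace BoundedQSAT

/-! ## Quantum states, clauses and instances -/

/-- A vector of complex amplitudes has norm one, i.e. it is a (pure) state. -/
def IsState {ι : Type} [Fintype ι] (v : ι → ℂ) : Prop :=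
  ∑ i, ‖v i‖ ^ 2 = 1

/-- The product state `⨂ q, φ q` on `n` qubits: its amplitude at the computational basis
vector `x` is the product of the amplitudes of the factors. -/
def productState {n : ℕ} (φ : Fin n → Fin 2 → ℂ) : (Fin n → Fin 2) → ℂ :=
  fun x => ∏ q, φ q (x q)

/-- A rank-one clause on `n` qubits: a unit vector `amp` in the space `(ℂ²)^{⊗ loc}` of `loc`
distinct qubits `qubit 0, …, qubit (loc - 1)`. -/
structure Clause (n : ℕ) where
  loc : ℕ
  qubit : Fin loc ↪ Fin n
  amp : (Fin loc → Fin 2) → ℂ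
  isState : IsState amp

/-- The operator `|amp⟩⟨amp| ⊗ 1` on all `n` qubits, as a matrix in the computational basis:
the rank-one projector on the qubits of the clause, the identity on the others. -/
def Clause.proj {n : ℕ} (c : Clause n) : Matrix (Fin n → Fin 2) (Fin n → Fin 2) ℂ :=
  Matrix.of fun x y =>
    if ∀ q, (∀ i, c.qubit i ≠ q) → x q = y q then
      c.amp (x ∘ c.qubit) * star (c.amp (y ∘ c.qubit))
    else 0

/-- An instance on `n` qubits with `m` rank-one clauses, each of locality between `1` and `k`.
The clauses form an indexed family, so several of them may act on the same qubits. -/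
structure Instance (k n : ℕ) where
  m : ℕ
  clause : Fin m → Clause n
  one_le_loc : ∀ j, 1 ≤ (clause j).loc
  loc_le : ∀ j, (clause j).loc ≤ k

namespace Instance

variable {k n : ℕ} (I : Instance k n)

/-- The number of clauses in which the qubit `q` occurs. -/
def occurrences (q : Fin n) : ℕ :=
  (Finset.univ.filter fun j : Fin I.m => ∃ i, (I.clause j).qubit i = q).card

/-- The `n`-qubit vector `ψ` is a satisfying state: a state annihilated by every clause. -/
def SatisfiedBy (ψ : (Fin n → Fin 2) → ℂ) : Prop :=
  IsState ψ ∧ ∀ j, (I.clause j).proj.mulVec ψ = 0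

/-- Some state of the `n` qubits, possibly entangled, satisfies all clauses. -/
def Satisfiable : Prop :=
  ∃ ψ, I.SatisfiedBy ψ

/-- The length of the input: number of qubits, number of clauses and, for each clause, the list
of its qubits and the list of its amplitudes. -/
def size : ℕ :=
  n + I.m + ∑ j, ((I.clause j).loc + 2 ^ (I.clause j).loc)

end Instance

/-! ## Random access machines over the complex numbers

Programs are finite and work on finitely many named arrays of natural numbers (used for indices
and bookkeeping) and of complex numbers. Every arithmetic operation, memory access, literal, test
and command costs one step. There is no conversion of complex numbers to natural numbers, the only
complex constants are `0` and `1`, and natural numbers are only added and subtracted. -/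

/-- The memory: cell `i` of the array named `a`, for natural and for complex arrays. -/
structure Memory where
  nat : ℕ → ℕ → ℕ
  cpx : ℕ → ℕ → ℂ

/-- Expressions of type `ℕ`. -/
inductive NExp where
  | lit (v : ℕ)
  | get (a : ℕ) (i : NExp)
  | add (e f : NExp)
  | sub (e f : NExp)

/-- Expressions of type `ℂ`. -/
inductive CExp where
  | zero
  | one
  | get (a : ℕ) (i : NExp)
  | add (e f : CExp)
  | sub (e f : CExp)
  | mul (e f : CExp)
  | div (e f : CExp)
  | conj (e : CExp)
  | sqrt (e : CExp)

/-- Tests: comparison of natural numbers, zero test for complex numbers, Boolean combinations. -/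
inductive Test where
  | le (e f : NExp)
  | isZero (e : CExp)
  | not (b : Test)
  | and (b c : Test)

/-- Programs. -/
inductive Program where
  | skip
  | setNat (a : ℕ) (i e : NExp)
  | setCpx (a : ℕ) (i : NExp) (e : CExp)
  | seq (P Q : Program)
  | ite (b : Test) (P Q : Program)
  | loop (b : Test) (P : Program)

def NExp.eval (s : Memory) : NExp → ℕ
  | .lit v => v
  | .get a i => s.nat a (i.eval s)
  | .add e f => e.eval s + f.eval s
  | .sub e f => e.eval s - f.eval s

/-- The number of steps needed to evaluate an expression. -/
def NExp.cost : NExp → ℕ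
  | .lit _ => 1
  | .get _ i => i.cost + 1
  | .add e f => e.cost + f.cost + 1
  | .sub e f => e.cost + f.cost + 1

/-- Here `sqrt` is the principal square root, and the quotient by `0` is `0`. -/
def CExp.eval (s : Memory) : CExp → ℂ
  | .zero => 0
  | .one => 1
  | .get a i => s.cpx a (i.eval s)
  | .add e f => e.eval s + f.eval s
  | .sub e f => e.eval s - f.eval s
  | .mul e f => e.eval s * f.eval s
  | .div e f => e.eval s / f.eval s
  | .conj e => star (e.eval s)
  | .sqrt e => Complex.sqrt (e.eval s)

/-- The number of steps needed to evaluate an expression. -/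
def CExp.cost : CExp → ℕ
  | .zero => 1
  | .one => 1
  | .get _ i => i.cost + 1
  | .add e f => e.cost + f.cost + 1
  | .sub e f => e.cost + f.cost + 1
  | .mul e f => e.cost + f.cost + 1
  | .div e f => e.cost + f.cost + 1
  | .conj e => e.cost + 1
  | .sqrt e => e.cost + 1

def Test.Holds (s : Memory) : Test → Prop
  | .le e f => e.eval s ≤ f.eval s
  | .isZero e => e.eval s = 0
  | .not b => ¬ b.Holds s
  | .and b c => b.Holds s ∧ c.Holds s

/-- The number of steps needed to evaluate a test. -/
def Test.cost : Test → ℕ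
  | .le e f => e.cost + f.cost + 1
  | .isZero e => e.cost + 1
  | .not b => b.cost + 1
  | .and b c => b.cost + c.cost + 1

def Memory.writeNat (s : Memory) (a i v : ℕ) : Memory :=
  { s with nat := Function.update s.nat a (Function.update (s.nat a) i v) }

def Memory.writeCpx (s : Memory) (a i : ℕ) (z : ℂ) : Memory :=
  { s with cpx := Function.update s.cpx a (Function.update (s.cpx a) i z) }

/-- `Runs P s t u`: started in memory `s`, the program `P` halts after exactly `t` steps
in memory `u`. -/
inductive Runs : Program → Memory → ℕ → Memory → Prop
  | skip (s) : Runs .skip s 1 s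
  | setNat (s a i e) :
      Runs (.setNat a i e) s (i.cost + e.cost + 1) (s.writeNat a (i.eval s) (e.eval s))
  | setCpx (s a i e) :
      Runs (.setCpx a i e) s (i.cost + e.cost + 1) (s.writeCpx a (i.eval s) (e.eval s))
  | seq {P Q s t u t₁ u₁} (hP : Runs P s t u) (hQ : Runs Q u t₁ u₁) :
      Runs (.seq P Q) s (t + t₁) u₁
  | iteTrue {b P Q s t u} (hb : b.Holds s) (hP : Runs P s t u) :
      Runs (.ite b P Q) s (b.cost + 1 + t) u
  | iteFalse {b P Q s t u} (hb : ¬ b.Holds s) (hQ : Runs Q s t u) :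
      Runs (.ite b P Q) s (b.cost + 1 + t) u
  | loopDone {b P s} (hb : ¬ b.Holds s) :
      Runs (.loop b P) s (b.cost + 1) s
  | loopStep {b P s t u t₁ u₁} (hb : b.Holds s) (hP : Runs P s t u)
      (hL : Runs (.loop b P) u t₁ u₁) :
      Runs (.loop b P) s (b.cost + 1 + t + t₁) u₁

/-- Execution is deterministic: running time and final memory depend only on the program and
the initial memory. -/
theorem Runs.deterministic {P : Program} {s u u₁ : Memory} {t t₁ : ℕ}
    (h : Runs P s t u) (h₁ : Runs P s t₁ u₁) : t = t₁ ∧ u = u₁ := by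
  induction h generalizing t₁ u₁ with
  | skip => cases h₁; exact ⟨rfl, rfl⟩
  | setNat => cases h₁; exact ⟨rfl, rfl⟩
  | setCpx => cases h₁; exact ⟨rfl, rfl⟩
  | seq hP hQ ihP ihQ =>
    cases h₁ with
    | seq hP₁ hQ₁ =>
      obtain ⟨rfl, rfl⟩ := ihP hP₁
      obtain ⟨rfl, rfl⟩ := ihQ hQ₁
      exact ⟨rfl, rfl⟩
  | iteTrue hb hP ih =>
    cases h₁ with
    | iteTrue _ hP₁ => obtain ⟨rfl, rfl⟩ := ih hP₁; exact ⟨rfl, rfl⟩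
    | iteFalse hb₁ _ => exact absurd hb hb₁
  | iteFalse hb hP ih =>
    cases h₁ with
    | iteTrue hb₁ _ => exact absurd hb₁ hb
    | iteFalse _ hP₁ => obtain ⟨rfl, rfl⟩ := ih hP₁; exact ⟨rfl, rfl⟩
  | loopDone hb =>
    cases h₁ with
    | loopDone _ => exact ⟨rfl, rfl⟩
    | loopStep hb₁ _ _ => exact absurd hb₁ hb
  | loopStep hb hP hL ihP ihL =>
    cases h₁ with
    | loopDone hb₁ => exact absurd hb hb₁
    | loopStep _ hP₁ hL₁ =>
      obtain ⟨rfl, rfl⟩ := ihP hP₁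
      obtain ⟨rfl, rfl⟩ := ihL hL₁
      exact ⟨rfl, rfl⟩

/-! ## Input and output -/

/-- The initial memory. Natural array `0` holds the numbers of qubits and of clauses, natural
array `1` the localities of the clauses, natural array `2` the concatenation of the lists of
qubits of the clauses, complex array `0` the concatenation of their lists of amplitudes. The
amplitude of a clause at the basis vector `x` is at position `∑ i, x i * 2 ^ i` of its list.
All other cells hold `0`. -/
def Instance.encode {k n : ℕ} (I : Instance k n) : Memory where
  nat a i :=
    if a = 0 then [n, I.m].getD i 0
    else if a = 1 then (List.ofFn fun j => (I.clause j).loc).getD i 0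
    else if a = 2 then
      (List.ofFn fun j => List.ofFn fun l => ((I.clause j).qubit l : ℕ)).flatten.getD i 0
    else 0
  cpx a i :=
    if a = 0 then
      (List.ofFn fun j => List.ofFn fun l : Fin (2 ^ (I.clause j).loc) =>
        (I.clause j).amp (finFunctionFinEquiv.symm l)).flatten.getD i 0
    else 0

/-- The verdict is read from cell `0` of natural array `3`: `1` means accept. -/
def Memory.Accepts (s : Memory) : Prop := s.nat 3 0 = 1

/-- The verdict is read from cell `0` of natural array `3`: `0` means reject. -/
def Memory.Rejects (s : Memory) : Prop := s.nat 3 0 = 0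

/-- The output of one vector of `ℂ²` per qubit, the two amplitudes of the qubit `q` being in the
cells `2 * q` and `2 * q + 1` of complex array `1`. -/
def Memory.output (s : Memory) {n : ℕ} (q : Fin n) (x : Fin 2) : ℂ :=
  s.cpx 1 (2 * (q : ℕ) + (x : ℕ))

end BoundedQSAT

end

/-!
The algorithm is unit propagation on product states. A clause all of whose qubits but one, `q`, have
got a vector induces a linear form on the space `ℂ²` of `q`. If the form is zero, the clause is
settled; otherwise `q` gets the vector in its kernel. A clause all of whose qubits have got vectors
is settled or violated according to its scalar product with them, the residual.

*Before any choice is made* all steps are forced, also for entangled states: a satisfying vector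
factors at each assigned qubit as prescribed (`Instance.Forced`). This is proved for one qubit at a
time by means of the relation `φ p 0 * ψ (x, p ↦ 1) = φ p 1 * ψ (x, p ↦ 0)` (`FactorsAt`). So a
violation now means that the instance is not satisfiable.

*Afterwards violations can always be avoided.* When propagation has come to rest, every unsettled
clause has at least two free qubits. Give a vector `v` to a free qubit `q` and propagate again.
Consider the number of incidences between unsettled clauses and qubits assigned since then
(`Instance.load`). It is at most two at the start and never grows, because each newly assigned qubit
uses up an incidence with the clause that determines it and lies in at most one other clause.
A violated clause would have at least two such incidences and a unit clause has at least one, so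
nothing can go wrong once the load is at most one (`Instance.Safe`). As long as it stays at two, the
course of the propagation does not depend on `v`, each unit clause contains exactly one newly
assigned qubit (processing one with two of them lowers the load to at most one), and all new vectors
are linear in `v` if they are not normalised. Hence a violation can only occur in a clause with two
newly assigned qubits, and the residual is a fixed quadratic form of `v` (`Instance.Lockstep.step`,
`Instance.exists_isQuad`). The algorithm tries `(1, 0)`, `(0, 1)` and `(1, 1)`. If all of them fail,
their residuals determine the form, and a root of it, which takes one square root, succeeds
(`IsQuad.root`). No graph search is needed.

*Running time.* Each loop of the program makes at most as many passes as the input is long, so a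
polynomial bound can be read off from the program (`Program.timePoly`). The predicate `Wp` states
total correctness within this bound, and `Frame` that arrays not assigned to keep their values.
-/

noncomputable section

namespace BoundedQSAT

/-! ### Running time and frame of a program -/

/-- A bound on the running time of a program all of whose loops make at most `X` passes. -/
def Program.timePoly : Program → Polynomial ℕ
  | .skip => 1
  | .setNat _ i e => Polynomial.C (i.cost + e.cost + 1)
  | .setCpx _ i e => Polynomial.C (i.cost + e.cost + 1)
  | .seq P Q => P.timePoly + Q.timePoly
  | .ite b P Q => Polynomial.C (b.cost + 1) + P.timePoly + Q.timePoly
  | .loop b P =>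
      Polynomial.X * (Polynomial.C (b.cost + 1) + P.timePoly) + Polynomial.C (b.cost + 1)

/-- Does the program contain an assignment to the natural array `a`? -/
def Program.writesNat (a : ℕ) : Program → Bool
  | .skip => false
  | .setNat b _ _ => a == b
  | .setCpx _ _ _ => false
  | .seq P Q => P.writesNat a || Q.writesNat a
  | .ite _ P Q => P.writesNat a || Q.writesNat a
  | .loop _ P => P.writesNat a

/-- Does the program contain an assignment to the complex array `a`? -/
def Program.writesCpx (a : ℕ) : Program → Bool
  | .skip => false
  | .setNat _ _ _ => false
  | .setCpx b _ _ => a == b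
  | .seq P Q => P.writesCpx a || Q.writesCpx a
  | .ite _ P Q => P.writesCpx a || Q.writesCpx a
  | .loop _ P => P.writesCpx a

/-- The memories `s` and `u` agree on all arrays that `P` does not assign to. -/
structure Frame (P : Program) (s u : Memory) : Prop where
  nat : ∀ a, P.writesNat a = false → u.nat a = s.nat a
  cpx : ∀ a, P.writesCpx a = false → u.cpx a = s.cpx a

theorem Frame.refl (P : Program) (s : Memory) : Frame P s s := ⟨fun _ _ => rfl, fun _ _ => rfl⟩

theorem Frame.trans {P : Program} {s u w : Memory} (h : Frame P s u) (h' : Frame P u w) :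
    Frame P s w :=
  ⟨fun a ha => (h'.nat a ha).trans (h.nat a ha), fun a ha => (h'.cpx a ha).trans (h.cpx a ha)⟩

theorem Memory.writeNat_nat_of_ne (s : Memory) {a b : ℕ} (i v : ℕ) (h : b ≠ a) :
    (s.writeNat a i v).nat b = s.nat b := by
  simp [Memory.writeNat, Function.update_of_ne h]

theorem Memory.writeCpx_cpx_of_ne (s : Memory) {a b : ℕ} (i : ℕ) (z : ℂ) (h : b ≠ a) :
    (s.writeCpx a i z).cpx b = s.cpx b := by
  simp [Memory.writeCpx, Function.update_of_ne h]

theorem Memory.writeNat_nat (s : Memory) (a i v b j : ℕ) :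
    (s.writeNat a i v).nat b j = if b = a ∧ j = i then v else s.nat b j := by
  by_cases h : b = a
  · subst h; simp [Memory.writeNat, Function.update_apply]
  · simp [Memory.writeNat, h]

theorem Memory.writeCpx_cpx (s : Memory) (a i : ℕ) (z : ℂ) (b j : ℕ) :
    (s.writeCpx a i z).cpx b j = if b = a ∧ j = i then z else s.cpx b j := by
  by_cases h : b = a
  · subst h; simp [Memory.writeCpx, Function.update_apply]
  · simp [Memory.writeCpx, h]

theorem Memory.writeNat_cpx (s : Memory) (a i v : ℕ) : (s.writeNat a i v).cpx = s.cpx := rfl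

theorem Memory.writeCpx_nat (s : Memory) (a i : ℕ) (z : ℂ) : (s.writeCpx a i z).nat = s.nat := rfl

theorem Runs.frame {P : Program} {s u : Memory} {t : ℕ} (h : Runs P s t u) : Frame P s u := by
  induction h with
  | skip s => exact Frame.refl _ s
  | setNat s a i e =>
    refine ⟨fun b hb => s.writeNat_nat_of_ne _ _ ?_, fun _ _ => rfl⟩
    simpa [Program.writesNat] using hb
  | setCpx s a i e =>
    refine ⟨fun _ _ => rfl, fun b hb => s.writeCpx_cpx_of_ne _ _ ?_⟩
    simpa [Program.writesCpx] using hb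
  | seq _ _ ihP ihQ =>
    refine ⟨fun a ha => ?_, fun a ha => ?_⟩
    · simp only [Program.writesNat, Bool.or_eq_false_iff] at ha
      exact (ihQ.nat a ha.2).trans (ihP.nat a ha.1)
    · simp only [Program.writesCpx, Bool.or_eq_false_iff] at ha
      exact (ihQ.cpx a ha.2).trans (ihP.cpx a ha.1)
  | iteTrue _ _ ih =>
    refine ⟨fun a ha => ?_, fun a ha => ?_⟩
    · simp only [Program.writesNat, Bool.or_eq_false_iff] at ha
      exact ih.nat a ha.1
    · simp only [Program.writesCpx, Bool.or_eq_false_iff] at ha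
      exact ih.cpx a ha.1
  | iteFalse _ _ ih =>
    refine ⟨fun a ha => ?_, fun a ha => ?_⟩
    · simp only [Program.writesNat, Bool.or_eq_false_iff] at ha
      exact ih.nat a ha.2
    · simp only [Program.writesCpx, Bool.or_eq_false_iff] at ha
      exact ih.cpx a ha.2
  | loopDone _ => exact Frame.refl _ _
  | loopStep _ _ _ ihP ihL =>
    exact ⟨fun a ha => (ihL.nat a ha).trans (ihP.nat a ha),
      fun a ha => (ihL.cpx a ha).trans (ihP.cpx a ha)⟩

/-! ### Total correctness with a time bound -/

/-- Started in `s`, the program `P` halts in a memory with property `Q`, within the time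
`P.timePoly` allows when every loop makes at most `N` passes. -/
def Wp (N : ℕ) (P : Program) (s : Memory) (Q : Memory → Prop) : Prop :=
  ∃ t u, Runs P s t u ∧ t ≤ P.timePoly.eval N ∧ Q u

section

variable {N : ℕ} {P P' : Program} {s : Memory} {Q R : Memory → Prop}

theorem Wp.mono (h : Wp N P s Q) (hQ : ∀ u, Frame P s u → Q u → R u) : Wp N P s R := by
  obtain ⟨t, u, hr, ht, hu⟩ := h
  exact ⟨t, u, hr, ht, hQ u hr.frame hu⟩

theorem Wp.skip (h : Q s) : Wp N .skip s Q :=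
  ⟨1, s, .skip s, by simp [Program.timePoly], h⟩

theorem Wp.setNat {a : ℕ} {i e : NExp} (h : Q (s.writeNat a (i.eval s) (e.eval s))) :
    Wp N (.setNat a i e) s Q :=
  ⟨_, _, .setNat s a i e, by simp [Program.timePoly], h⟩

theorem Wp.setCpx {a : ℕ} {i : NExp} {e : CExp} (h : Q (s.writeCpx a (i.eval s) (e.eval s))) :
    Wp N (.setCpx a i e) s Q :=
  ⟨_, _, .setCpx s a i e, by simp [Program.timePoly], h⟩

theorem Wp.seq (h : Wp N P s fun u => Wp N P' u Q) : Wp N (.seq P P') s Q := by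
  obtain ⟨t, u, hr, ht, t', u', hr', ht', hu⟩ := h
  exact ⟨_, u', .seq hr hr', by simp only [Program.timePoly, Polynomial.eval_add]; omega, hu⟩

theorem Wp.ite {b : Test} (h : b.Holds s → Wp N P s Q) (h' : ¬ b.Holds s → Wp N P' s Q) :
    Wp N (.ite b P P') s Q := by
  by_cases hb : b.Holds s
  · obtain ⟨t, u, hr, ht, hu⟩ := h hb
    refine ⟨_, u, .iteTrue hb hr, ?_, hu⟩
    simp only [Program.timePoly, Polynomial.eval_add, Polynomial.eval_C]; omega
  · obtain ⟨t, u, hr, ht, hu⟩ := h' hb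
    refine ⟨_, u, .iteFalse hb hr, ?_, hu⟩
    simp only [Program.timePoly, Polynomial.eval_add, Polynomial.eval_C]; omega

/-- The scalar variable kept in cell `0` of the natural array `a`. -/
abbrev NExp.var (a : ℕ) : NExp := .get a (.lit 0)

/-- The loop `for k = 0, …, e - 1 do P`. -/
def Program.forTo (k : ℕ) (e : NExp) (P : Program) : Program :=
  .seq (.setNat k (.lit 0) (.lit 0))
    (.loop (.le (.add (.var k) (.lit 1)) e)
      (.seq P (.setNat k (.lit 0) (.add (.var k) (.lit 1)))))

/-- The rule for counting loops: the invariant `Inv j` holds before pass `j`. The values of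
arrays that the loop does not assign to need not be part of the invariant. -/
theorem Wp.forTo {k n : ℕ} {e : NExp} (Inv : ℕ → Memory → Prop)
    (hk : P.writesNat k = false) (hn : n ≤ N)
    (he : ∀ u, Frame (.forTo k e P) s u → e.eval u = n)
    (hw : ∀ j u v, Inv j u → Inv j (u.writeNat k 0 v))
    (h0 : Inv 0 s)
    (hstep : ∀ j u, j < n → Frame (.forTo k e P) s u → u.nat k 0 = j → Inv j u →
      Wp N P u (Inv (j + 1)))
    (hQ : ∀ u, Frame (.forTo k e P) s u → Inv n u → Q u) :
    Wp N (.forTo k e P) s Q := by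
  set B : Program := .seq P (.setNat k (.lit 0) (.add (.var k) (.lit 1))) with hB
  set b : Test := .le (.add (.var k) (.lit 1)) e with hb
  have hfr : ∀ u u', Frame (.loop b B) u u' → Frame (.forTo k e P) u u' := by
    intro u u' h
    refine ⟨fun a ha => h.nat a ?_, fun a ha => h.cpx a ?_⟩
    · simp only [Program.forTo, Program.writesNat, Bool.or_eq_false_iff] at ha
      simpa [hB, Program.writesNat] using ha.2
    · simp only [Program.forTo, Program.writesCpx, Bool.or_eq_false_iff] at ha
      simpa [hB, Program.writesCpx] using ha.2
  have hloop : ∀ d j u, d + j = n → Frame (.forTo k e P) s u → u.nat k 0 = j → Inv j u →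
      ∃ t u', Runs (.loop b B) u t u' ∧
        t ≤ d * (b.cost + 1 + B.timePoly.eval N) + (b.cost + 1) ∧ Inv n u' := by
    intro d
    induction d with
    | zero =>
      intro j u hj hf hu hI
      refine ⟨_, u, .loopDone ?_, by simp, ?_⟩
      · simp only [hb, Test.Holds, NExp.eval, he u hf, hu]; omega
      · have : j = n := by omega
        exact this ▸ hI
    | succ d ih =>
      intro j u hj hf hu hI
      obtain ⟨t, w, hr, ht, hw'⟩ := hstep j u (by omega) hf hu hI
      have hwk : w.nat k 0 = j := by rw [hr.frame.nat k hk, hu]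
      have hrB : Runs B u _ _ := .seq hr (.setNat w k (.lit 0) (.add (.var k) (.lit 1)))
      have hval : (NExp.add (.var k) (.lit 1)).eval w = j + 1 := by simp [NExp.eval, hwk]
      rw [hval] at hrB
      have hfB : Frame (.loop b B) u (w.writeNat k 0 (j + 1)) :=
        ⟨fun a ha => hrB.frame.nat a ha, fun a ha => hrB.frame.cpx a ha⟩
      obtain ⟨t', u', hr', ht', hI'⟩ := ih (j + 1) (w.writeNat k 0 (j + 1)) (by omega)
        (hf.trans (hfr _ _ hfB)) (by simp [Memory.writeNat_nat]) (hw _ _ _ hw')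
      refine ⟨_, u', .loopStep ?_ hrB hr', ?_, hI'⟩
      · simp only [hb, Test.Holds, NExp.eval, he u hf, hu]; omega
      · have hBt : B.timePoly.eval N = P.timePoly.eval N + 6 := by
          simp [hB, Program.timePoly, NExp.cost]
        have h6 : (NExp.lit 0).cost + (NExp.add (.var k) (.lit 1)).cost + 1 = 6 := rfl
        rw [h6, Nat.succ_mul]
        omega
  have hf0 : Frame (.forTo k e P) s (s.writeNat k 0 0) := by
    refine ⟨fun a ha => s.writeNat_nat_of_ne _ _ ?_, fun _ _ => rfl⟩
    simp only [Program.forTo, Program.writesNat, Bool.or_eq_false_iff] at ha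
    simpa using ha.1
  obtain ⟨t, u, hr, ht, hI⟩ := hloop n 0 (s.writeNat k 0 0) rfl hf0
    (by simp [Memory.writeNat_nat]) (hw _ _ _ h0)
  refine ⟨_, u, .seq (.setNat s k (.lit 0) (.lit 0)) hr, ?_, ?_⟩
  · have := Nat.mul_le_mul_right (b.cost + 1 + B.timePoly.eval N) hn
    have hT : (Program.forTo k e P).timePoly.eval N =
        3 + (N * (b.cost + 1 + B.timePoly.eval N) + (b.cost + 1)) := by
      simp [Program.forTo, Program.timePoly, NExp.cost, hB, hb]
    have h3 : (NExp.lit 0).cost + (NExp.lit 0).cost + 1 = 3 := rfl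
    rw [hT, h3]
    omega
  · exact hQ u (hf0.trans (hfr _ _ hr.frame)) hI

end

/-! ### Clauses as multilinear forms -/

/-- The qubits on which a clause acts. -/
def Clause.supp {n : ℕ} (c : Clause n) : Finset (Fin n) := Finset.univ.map c.qubit

/-- The scalar product `⟨c|φ⟩` of a clause with the product of the vectors `φ q` over the qubits
`q` of the clause. -/
def Clause.pairing {n : ℕ} (c : Clause n) (φ : Fin n → Fin 2 → ℂ) : ℂ :=
  ∑ y, star (c.amp y) * ∏ i, φ (c.qubit i) (y i)

/-- The basis vector `b` of `ℂ²`. -/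
def ket (b : Fin 2) : Fin 2 → ℂ := Pi.single b 1

namespace Clause

variable {n : ℕ} (c : Clause n) {φ φ' : Fin n → Fin 2 → ℂ}

theorem mem_supp {q : Fin n} : q ∈ c.supp ↔ ∃ i, c.qubit i = q := by
  simp [supp]

theorem qubit_mem_supp (i : Fin c.loc) : c.qubit i ∈ c.supp := c.mem_supp.2 ⟨i, rfl⟩

theorem pairing_congr (h : ∀ q ∈ c.supp, φ q = φ' q) : c.pairing φ = c.pairing φ' := by
  unfold pairing
  refine Finset.sum_congr rfl fun y _ => ?_
  congr 1
  exact Finset.prod_congr rfl fun i _ => by rw [h _ (c.qubit_mem_supp i)]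

theorem prod_supp (f : Fin n → Fin 2 → ℂ) (y : Fin c.loc → Fin 2) (x : Fin n → Fin 2) :
    ∏ i, f (c.qubit i) (y i) = ∏ p ∈ c.supp, f p (Function.extend c.qubit y x p) := by
  simp [supp, Finset.prod_map, c.qubit.injective.extend_apply]

theorem pairing_update {q : Fin n} (hq : q ∈ c.supp) (w : Fin 2 → ℂ) :
    c.pairing (Function.update φ q w) = w 0 * c.pairing (Function.update φ q (ket 0)) +
      w 1 * c.pairing (Function.update φ q (ket 1)) := by
  obtain ⟨i₀, rfl⟩ := c.mem_supp.1 hq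
  unfold pairing
  rw [Finset.mul_sum, Finset.mul_sum, ← Finset.sum_add_distrib]
  refine Finset.sum_congr rfl fun y _ => ?_
  have key : ∀ w : Fin 2 → ℂ, ∏ i, Function.update φ (c.qubit i₀) w (c.qubit i) (y i) =
      w (y i₀) * ∏ i ∈ Finset.univ.erase i₀, φ (c.qubit i) (y i) := by
    intro w
    rw [← Finset.mul_prod_erase _ _ (Finset.mem_univ i₀)]
    congr 1
    · simp
    · refine Finset.prod_congr rfl fun i hi => ?_
      rw [Function.update_of_ne]
      exact fun h => (Finset.ne_of_mem_erase hi) (c.qubit.injective h)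
  rw [key, key, key]
  have hw : w (y i₀) = w 0 * ket 0 (y i₀) + w 1 * ket 1 (y i₀) := by
    rcases Fin.exists_fin_two.1 ⟨y i₀, rfl⟩ with h | h <;> simp [h, ket]
  rw [hw]; ring

theorem pairing_div (w : Fin n → ℂ) (h : c.pairing φ = 0) :
    c.pairing (fun q b => φ q b / w q) = 0 := by
  have : c.pairing (fun q b => φ q b / w q) = c.pairing φ / ∏ i, w (c.qubit i) := by
    simp only [pairing, Finset.prod_div_distrib, Finset.sum_div, mul_div_assoc]
  rw [this, h, zero_div]

/-! ### Satisfaction of a clause -/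

theorem mulVec_proj (ψ : (Fin n → Fin 2) → ℂ) (x : Fin n → Fin 2) :
    c.proj.mulVec ψ x = c.amp (x ∘ c.qubit) *
      ∑ y, star (c.amp y) * ψ (Function.extend c.qubit y x) := by
  simp only [Matrix.mulVec, dotProduct, proj, Matrix.of_apply, ite_mul, zero_mul]
  rw [← Finset.sum_filter, Finset.mul_sum]
  refine Finset.sum_bij' (fun z _ => z ∘ c.qubit) (fun y _ => Function.extend c.qubit y x)
    (fun _ _ => Finset.mem_univ _) ?_ ?_ ?_ ?_
  · intro y _
    simp only [Finset.mem_filter, Finset.mem_univ, true_and]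
    intro q hq
    rw [Function.extend_apply' _ _ _ (by rintro ⟨i, hi⟩; exact hq i hi)]
  · intro z hz
    simp only [Finset.mem_filter, Finset.mem_univ, true_and] at hz
    funext q
    by_cases h : ∃ i, c.qubit i = q
    · obtain ⟨i, rfl⟩ := h
      rw [c.qubit.injective.extend_apply]; rfl
    · rw [Function.extend_apply' _ _ _ h]
      exact hz q fun i hi => h ⟨i, hi⟩
  · intro y _
    funext i
    simp [c.qubit.injective.extend_apply]
  · intro z hz
    simp only [Finset.mem_filter, Finset.mem_univ, true_and] at hz
    have : Function.extend c.qubit (z ∘ c.qubit) x = z := by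
      funext q
      by_cases h : ∃ i, c.qubit i = q
      · obtain ⟨i, rfl⟩ := h
        rw [c.qubit.injective.extend_apply]; rfl
      · rw [Function.extend_apply' _ _ _ h]
        exact hz q fun i hi => h ⟨i, hi⟩
    simp only [this]; ring

theorem exists_amp_ne_zero : ∃ y, c.amp y ≠ 0 := by
  by_contra! h
  have := c.isState
  simp [IsState, h] at this

/-- A clause annihilates `ψ` iff its partial scalar product with `ψ` vanishes. -/
theorem mulVec_proj_eq_zero (ψ : (Fin n → Fin 2) → ℂ) :
    c.proj.mulVec ψ = 0 ↔ ∀ x, ∑ y, star (c.amp y) * ψ (Function.extend c.qubit y x) = 0 := by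
  constructor
  · intro h x
    obtain ⟨y₀, hy₀⟩ := c.exists_amp_ne_zero
    have := congrFun h (Function.extend c.qubit y₀ x)
    rw [mulVec_proj] at this
    have hcomp : Function.extend c.qubit y₀ x ∘ c.qubit = y₀ := by
      funext i; simp [c.qubit.injective.extend_apply]
    have hext : ∀ y, Function.extend c.qubit y (Function.extend c.qubit y₀ x) =
        Function.extend c.qubit y x := by
      intro y; funext q
      by_cases h : ∃ i, c.qubit i = q
      · obtain ⟨i, rfl⟩ := h
        simp [c.qubit.injective.extend_apply]
      · simp [Function.extend_apply' _ _ _ h]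
    simp only [hcomp, hext, Pi.zero_apply, mul_eq_zero, hy₀, false_or] at this
    exact this
  · intro h
    funext x
    rw [mulVec_proj, h, mul_zero, Pi.zero_apply]

theorem mulVec_proj_productState (h : c.pairing φ = 0) :
    c.proj.mulVec (productState φ) = 0 := by
  rw [mulVec_proj_eq_zero]
  intro x
  have : ∀ y, star (c.amp y) * productState φ (Function.extend c.qubit y x) =
      (star (c.amp y) * ∏ i, φ (c.qubit i) (y i)) * ∏ p ∈ c.suppᶜ, φ p (x p) := by
    intro y
    rw [productState, ← Finset.prod_mul_prod_compl c.supp, c.prod_supp φ y x, mul_assoc]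
    congr 2
    refine Finset.prod_congr rfl fun p hp => ?_
    rw [Function.extend_apply']
    rw [← c.mem_supp]; simpa using hp
  simp only [this]
  rw [← Finset.sum_mul]
  change c.pairing φ * _ = 0
  rw [h, zero_mul]

end Clause

theorem isState_productState {n : ℕ} {φ : Fin n → Fin 2 → ℂ} (h : ∀ q, IsState (φ q)) :
    IsState (productState φ) := by
  have : ∑ x : Fin n → Fin 2, ∏ q, ‖φ q (x q)‖ ^ 2 = ∏ q, ∑ b, ‖φ q b‖ ^ 2 := by
    rw [Finset.prod_univ_sum, Fintype.piFinset_univ]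
  simp only [IsState, productState, norm_prod, ← Finset.prod_pow, this]
  exact Finset.prod_eq_one fun q _ => h q

/-! ### Vectors that factor at a qubit -/

/-- The vector `ψ` factors as `φ p` at the qubit `p` times a vector on the other qubits. -/
def FactorsAt {n : ℕ} (ψ : (Fin n → Fin 2) → ℂ) (φ : Fin n → Fin 2 → ℂ) (p : Fin n) : Prop :=
  ∀ x, φ p 0 * ψ (Function.update x p 1) = φ p 1 * ψ (Function.update x p 0)

section

variable {n : ℕ} {ψ : (Fin n → Fin 2) → ℂ} {φ : Fin n → Fin 2 → ℂ}

theorem FactorsAt.swap {p : Fin n} (h : FactorsAt ψ φ p) (x : Fin n → Fin 2) (b : Fin 2) :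
    φ p b * ψ x = φ p (x p) * ψ (Function.update x p b) := by
  have hx := h x
  have hself : Function.update x p (x p) = x := Function.update_eq_self p x
  rcases Fin.exists_fin_two.1 ⟨x p, rfl⟩ with h' | h' <;>
    rcases Fin.exists_fin_two.1 ⟨b, rfl⟩ with hb | hb <;>
    rw [h'] at hself ⊢ <;> rw [hb]
  · rw [hself]
  · rwa [hself, eq_comm] at hx
  · rwa [hself] at hx
  · rw [hself]

theorem prod_mul_of_factorsAt (T : Finset (Fin n)) (h : ∀ p ∈ T, FactorsAt ψ φ p) :
    ∀ x z : Fin n → Fin 2, (∀ p ∉ T, x p = z p) →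
      (∏ p ∈ T, φ p (z p)) * ψ x = (∏ p ∈ T, φ p (x p)) * ψ z := by
  induction T using Finset.induction_on with
  | empty =>
    intro x z hxz
    have : x = z := funext fun p => hxz p (by simp)
    simp [this]
  | insert p T hp ih =>
    intro x z hxz
    rw [Finset.prod_insert hp, Finset.prod_insert hp]
    have ih' := ih (fun p' hp' => h p' (Finset.mem_insert_of_mem hp'))
      (Function.update x p (z p)) z (by
        intro p' hp'
        by_cases hpp : p' = p
        · subst hpp; simp
        · rw [Function.update_of_ne hpp]
          exact hxz p' (by simp [hpp, hp']))
    have hT : ∏ p' ∈ T, φ p' (Function.update x p (z p) p') = ∏ p' ∈ T, φ p' (x p') := by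
      refine Finset.prod_congr rfl fun p' hp' => ?_
      rw [Function.update_of_ne]
      rintro rfl; exact hp hp'
    rw [hT] at ih'
    have hs := (h p (Finset.mem_insert_self _ _)).swap x (z p)
    calc φ p (z p) * (∏ p' ∈ T, φ p' (z p')) * ψ x
        = (∏ p' ∈ T, φ p' (z p')) * (φ p (z p) * ψ x) := by ring
      _ = φ p (x p) * ((∏ p' ∈ T, φ p' (z p')) * ψ (Function.update x p (z p))) := by
          rw [hs]; ring
      _ = _ := by rw [ih']; ring

/-- If a satisfying vector factors at all qubits of a clause, the clause pairs to zero with the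
factors. -/
theorem pairing_mul_eq_zero {c : Clause n} (hc : c.proj.mulVec ψ = 0)
    (h : ∀ p ∈ c.supp, FactorsAt ψ φ p) (x : Fin n → Fin 2) : c.pairing φ * ψ x = 0 := by
  rw [Clause.mulVec_proj_eq_zero] at hc
  have : ∀ y, (star (c.amp y) * ∏ i, φ (c.qubit i) (y i)) * ψ x =
      (∏ p ∈ c.supp, φ p (x p)) * (star (c.amp y) * ψ (Function.extend c.qubit y x)) := by
    intro y
    rw [c.prod_supp φ y x, mul_assoc, prod_mul_of_factorsAt c.supp h x]
    · ring
    · intro p hp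
      rw [Function.extend_apply']
      rwa [← c.mem_supp]
  rw [Clause.pairing, Finset.sum_mul]
  simp only [this]
  rw [← Finset.mul_sum, hc, mul_zero]

/-- If a satisfying vector factors at all qubits of a clause but `q`, the clause yields a linear
equation for the amplitudes of the vector at `q`. -/
theorem pairing_update_eq_zero {c : Clause n} (hc : c.proj.mulVec ψ = 0) {q : Fin n}
    (hq : q ∈ c.supp) (h : ∀ p ∈ c.supp.erase q, FactorsAt ψ φ p) (x : Fin n → Fin 2) :
    c.pairing (Function.update φ q fun b => ψ (Function.update x q b)) = 0 := by
  rw [Clause.mulVec_proj_eq_zero] at hc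
  have : ∀ y, (star (c.amp y) * ∏ i, (Function.update φ q fun b => ψ (Function.update x q b))
      (c.qubit i) (y i)) =
      (∏ p ∈ c.supp.erase q, φ p (x p)) * (star (c.amp y) * ψ (Function.extend c.qubit y x)) := by
    intro y
    rw [c.prod_supp _ y x, ← Finset.mul_prod_erase _ _ hq, Function.update_self]
    set z := Function.extend c.qubit y x with hz
    have h1 : ∏ p ∈ c.supp.erase q, (Function.update φ q fun b => ψ (Function.update x q b)) p (z p)
        = ∏ p ∈ c.supp.erase q, φ p (z p) := by
      refine Finset.prod_congr rfl fun p hp => ?_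
      rw [Function.update_of_ne (Finset.ne_of_mem_erase hp)]
    have h2 := prod_mul_of_factorsAt _ h (Function.update x q (z q)) z (by
      intro p hp
      by_cases hpq : p = q
      · subst hpq; simp
      · rw [Function.update_of_ne hpq, hz, Function.extend_apply']
        rw [← c.mem_supp]
        intro hps; exact hp (Finset.mem_erase.2 ⟨hpq, hps⟩))
    have h3 : ∏ p ∈ c.supp.erase q, φ p (Function.update x q (z q) p)
        = ∏ p ∈ c.supp.erase q, φ p (x p) := by
      refine Finset.prod_congr rfl fun p hp => ?_
      rw [Function.update_of_ne (Finset.ne_of_mem_erase hp)]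
    rw [h1, mul_comm (ψ _), h2, h3]; ring
  rw [Clause.pairing]
  simp only [this]
  rw [← Finset.mul_sum, hc, mul_zero]

end

/-! ### Unit propagation -/

/-- A state of the algorithm: the set `A` of qubits that have got a vector, the set `D` of clauses
that need no further attention, the vectors `φ` (meaningful on `A`, not normalised), and the
residual `r`, nonzero iff some clause has been found to be violated. -/
structure State (n m : ℕ) where
  A : Finset (Fin n)
  D : Finset (Fin m)
  φ : Fin n → Fin 2 → ℂ
  r : ℂ

/-- Give the vector `v` to the qubit `q`. -/
def State.assign {n m : ℕ} (σ : State n m) (q : Fin n) (v : Fin 2 → ℂ) : State n m :=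
  { σ with A := insert q σ.A, φ := Function.update σ.φ q v }

namespace Instance

variable {k n : ℕ} (I : Instance k n)

/-- The qubits of the clause `c` that have no vector yet. -/
def free (σ : State n I.m) (c : Fin I.m) : Finset (Fin n) := (I.clause c).supp \ σ.A

/-- The amplitude `b` of the linear form that the clause `c` induces on its only free qubit `q`. -/
def form (σ : State n I.m) (c : Fin I.m) (q : Fin n) (b : Fin 2) : ℂ :=
  (I.clause c).pairing (Function.update σ.φ q (ket b))

/-- Process the clause `c`, whose only free qubit is `q`: if its linear form on `q` is nonzero,
give to `q` the vector in the kernel. -/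
def unitStep (σ : State n I.m) (c : Fin I.m) (q : Fin n) : State n I.m :=
  { A := if I.form σ c q 0 = 0 ∧ I.form σ c q 1 = 0 then σ.A else insert q σ.A
    D := insert c σ.D
    φ := Function.update σ.φ q ![-I.form σ c q 1, I.form σ c q 0]
    r := σ.r }

open Classical in
/-- Process the clause `c` if it has at most one free qubit. -/
def step (σ : State n I.m) (c : Fin I.m) : State n I.m :=
  if σ.r ≠ 0 ∨ c ∈ σ.D then σ
  else if I.free σ c = ∅ then { σ with D := insert c σ.D, r := (I.clause c).pairing σ.φ }
  else if h : ∃ q, I.free σ c = {q} then I.unitStep σ c h.choose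
  else σ

/-- Process all clauses once. -/
def sweep (σ : State n I.m) : State n I.m := (List.finRange I.m).foldl I.step σ

/-- Process all clauses as often as there are clauses. -/
def propagate (σ : State n I.m) : State n I.m := I.sweep^[I.m] σ

/-- No active clause has fewer than two free qubits, unless a violation has been found. -/
def Stable (σ : State n I.m) : Prop := σ.r = 0 → ∀ c ∉ σ.D, 2 ≤ (I.free σ c).card

variable {I} {σ : State n I.m} {c : Fin I.m}

theorem step_of_skip (h : σ.r ≠ 0 ∨ c ∈ σ.D) : I.step σ c = σ := by
  simp only [step, if_pos h]

theorem step_of_free_empty (hr : σ.r = 0) (hc : c ∉ σ.D) (h : I.free σ c = ∅) :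
    I.step σ c = { σ with D := insert c σ.D, r := (I.clause c).pairing σ.φ } := by
  rw [step, if_neg (by simp [hr, hc]), if_pos h]

theorem step_of_free_singleton (hr : σ.r = 0) (hc : c ∉ σ.D) {q : Fin n}
    (h : I.free σ c = {q}) : I.step σ c = I.unitStep σ c q := by
  have hex : ∃ q, I.free σ c = {q} := ⟨q, h⟩
  have hq : hex.choose = q :=
     Finset.singleton_injective (hex.choose_spec.symm.trans h)
  rw [step, if_neg (by simp [hr, hc]), if_neg (by simp [h]), dif_pos hex, hq]

theorem step_of_two_le (h : 2 ≤ (I.free σ c).card) : I.step σ c = σ := by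
  rw [step]
  split_ifs with h1 h2 h3
  · rfl
  · simp [h2] at h
  · obtain ⟨q, hq⟩ := h3
    simp [hq] at h
  · rfl

variable (σ c) in
/-- The possible effects of processing a clause. -/
theorem step_cases :
    ((σ.r ≠ 0 ∨ c ∈ σ.D ∨ 2 ≤ (I.free σ c).card) ∧ I.step σ c = σ) ∨
    (σ.r = 0 ∧ c ∉ σ.D ∧ I.free σ c = ∅ ∧
      I.step σ c = { σ with D := insert c σ.D, r := (I.clause c).pairing σ.φ }) ∨
    (σ.r = 0 ∧ c ∉ σ.D ∧ ∃ q, I.free σ c = {q} ∧ I.step σ c = I.unitStep σ c q) := by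
  by_cases h : σ.r ≠ 0 ∨ c ∈ σ.D
  · exact Or.inl ⟨by tauto, step_of_skip h⟩
  · push Not at h
    obtain h0 | h1 | h2 : (I.free σ c).card = 0 ∨ (I.free σ c).card = 1 ∨
        2 ≤ (I.free σ c).card := by omega
    · rw [Finset.card_eq_zero] at h0
      exact Or.inr (Or.inl ⟨h.1, h.2, h0, step_of_free_empty h.1 h.2 h0⟩)
    · obtain ⟨q, hq⟩ := Finset.card_eq_one.1 h1
      exact Or.inr (Or.inr ⟨h.1, h.2, q, hq, step_of_free_singleton h.1 h.2 hq⟩)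
    · exact Or.inl ⟨by tauto, step_of_two_le h2⟩

theorem foldl_step_induction {p : State n I.m → Prop} (hp : ∀ σ c, p σ → p (I.step σ c))
    (l : List (Fin I.m)) (h : p σ) : p (l.foldl I.step σ) := by
  induction l generalizing σ with
  | nil => exact h
  | cons c l ih => exact ih (hp σ c h)

theorem propagate_induction {p : State n I.m → Prop} (hp : ∀ σ c, p σ → p (I.step σ c))
    (h : p σ) : p (I.propagate σ) := by
  have key : ∀ t, p (I.sweep^[t] σ) := by
    intro t
    induction t with
    | zero => exact h
    | succ t ih =>
      rw [Function.iterate_succ_apply']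
      exact foldl_step_induction hp _ ih
  exact key I.m

/-! ### Propagation reaches a stable state -/

theorem subset_step_A : σ.A ⊆ (I.step σ c).A := by
  rcases step_cases σ c with ⟨_, h⟩ | ⟨_, _, _, h⟩ | ⟨_, _, q, _, h⟩ <;> rw [h]
  rw [unitStep]
  dsimp only
  split_ifs
  · rfl
  · exact Finset.subset_insert _ _

theorem subset_step_D : σ.D ⊆ (I.step σ c).D := by
  rcases step_cases σ c with ⟨_, h⟩ | ⟨_, _, _, h⟩ | ⟨_, _, q, _, h⟩ <;> rw [h]
  · exact Finset.subset_insert _ _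
  · exact Finset.subset_insert _ _

theorem foldl_step_mono (l : List (Fin I.m)) :
    σ.A ⊆ (l.foldl I.step σ).A ∧ σ.D ⊆ (l.foldl I.step σ).D :=
  foldl_step_induction (p := fun τ => σ.A ⊆ τ.A ∧ σ.D ⊆ τ.D)
    (fun _ _ h => ⟨h.1.trans subset_step_A, h.2.trans subset_step_D⟩) l ⟨subset_rfl, subset_rfl⟩

theorem r_eq_zero_of_foldl (l : List (Fin I.m)) (h : (l.foldl I.step σ).r = 0) : σ.r = 0 := by
  by_contra hσ
  exact foldl_step_induction (p := fun τ => τ.r ≠ 0)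
    (fun τ c hτ => by rwa [step_of_skip (Or.inl hτ)]) l hσ h

/-- A sweep without violation settles all clauses that have at most one free qubit. -/
theorem mem_sweep_D (hr : (I.sweep σ).r = 0) (hc : (I.free σ c).card ≤ 1) :
    c ∈ (I.sweep σ).D := by
  obtain ⟨l₁, l₂, hl⟩ := List.append_of_mem (List.mem_finRange c)
  rw [sweep, hl, List.foldl_append, List.foldl_cons] at hr ⊢
  refine (foldl_step_mono l₂).2 ?_
  have hr' := r_eq_zero_of_foldl _ hr
  set τ := l₁.foldl I.step σ with hτ
  have hτr : τ.r = 0 := r_eq_zero_of_foldl [c] hr'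
  have hτc : (I.free τ c).card ≤ 1 :=
    (Finset.card_le_card (Finset.sdiff_subset_sdiff subset_rfl (foldl_step_mono l₁).1)).trans hc
  rcases step_cases τ c with ⟨h, h'⟩ | ⟨_, _, _, h⟩ | ⟨_, _, q, _, h⟩
  · rw [h']
    rcases h with h | h | h
    · exact absurd hτr h
    · exact h
    · omega
  · rw [h]; exact Finset.mem_insert_self _ _
  · rw [h]; exact Finset.mem_insert_self _ _

theorem Stable.sweep_eq (h : I.Stable σ) : I.sweep σ = σ := by
  have hs : ∀ c, I.step σ c = σ := by
    intro c
    by_cases hc : σ.r ≠ 0 ∨ c ∈ σ.D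
    · exact step_of_skip hc
    · push Not at hc
      exact step_of_two_le (h hc.1 c hc.2)
  rw [sweep]
  induction List.finRange I.m with
  | nil => rfl
  | cons c l ih => rw [List.foldl_cons, hs, ih]

variable (σ) in
/-- A sweep of a state that is not stable settles a clause, unless it finds a violation, so there are
at most `m` such sweeps. -/
theorem stable_propagate : I.Stable (I.propagate σ) := by
  have key : ∀ t, I.Stable (I.sweep^[t] σ) ∨ t ≤ (I.sweep^[t] σ).D.card := by
    intro t
    induction t with
    | zero => exact Or.inr (Nat.zero_le _)
    | succ t ih =>
      rw [Function.iterate_succ_apply']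
      set τ := I.sweep^[t] σ
      by_cases hτ : I.Stable τ
      · left; rwa [hτ.sweep_eq]
      · by_cases hr : (I.sweep τ).r = 0
        · right
          have ht := ih.resolve_left hτ
          unfold Stable at hτ
          push Not at hτ
          obtain ⟨_, c, hc, hfree⟩ := hτ
          have : τ.D ⊂ (I.sweep τ).D :=
            Finset.ssubset_iff_subset_ne.2 ⟨(foldl_step_mono _).2, fun he =>
              hc (he ▸ mem_sweep_D hr (by omega))⟩
          exact ht.trans_lt (Finset.card_lt_card this)
        · exact Or.inl fun h => absurd h hr
  rcases key I.m with h | h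
  · exact h
  · intro _ c hc
    have : (I.propagate σ).D = Finset.univ := by
      refine Finset.eq_univ_of_card _ (le_antisymm (Finset.card_le_univ _) ?_)
      rw [Fintype.card_fin]
      exact h
    exact absurd (this ▸ Finset.mem_univ c) hc

/-! ### Invariants of propagation -/

variable (I) in
/-- The assigned vectors are nonzero and satisfy the clauses in `D`, whatever vectors the other
qubits get. -/
def Sound (σ : State n I.m) : Prop :=
  (∀ q ∈ σ.A, σ.φ q ≠ 0) ∧
    (σ.r = 0 → ∀ c ∈ σ.D, ∀ φ', (∀ q ∈ σ.A, φ' q = σ.φ q) → (I.clause c).pairing φ' = 0)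

variable (I) in
/-- All satisfying vectors factor at the assigned qubits as prescribed, and there are none if a
violation has been found. -/
def Forced (σ : State n I.m) : Prop :=
  ∀ ψ, I.SatisfiedBy ψ → (∀ q ∈ σ.A, FactorsAt ψ σ.φ q) ∧ σ.r = 0

theorem mem_supp_of_free {q : Fin n} (h : I.free σ c = {q}) :
    q ∈ (I.clause c).supp ∧ q ∉ σ.A ∧ ∀ p ∈ (I.clause c).supp, p ≠ q → p ∈ σ.A := by
  have hq : q ∈ I.free σ c := by simp [h]
  rw [free, Finset.mem_sdiff] at hq
  refine ⟨hq.1, hq.2, fun p hp hpq => ?_⟩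
  by_contra hpA
  have : p ∈ I.free σ c := Finset.mem_sdiff.2 ⟨hp, hpA⟩
  simp [h, hpq] at this

theorem Sound.step (h : I.Sound σ) : I.Sound (I.step σ c) := by
  rcases step_cases σ c with ⟨_, h'⟩ | ⟨hr, hc, hf, h'⟩ | ⟨hr, hc, q, hf, h'⟩ <;> rw [h']
  · exact h
  · refine ⟨h.1, fun hr' d hd φ' hφ' => ?_⟩
    rcases Finset.mem_insert.1 hd with rfl | hd
    · rw [← hr']
      refine (I.clause d).pairing_congr fun p hp => hφ' p ?_
      by_contra hpA
      have : p ∈ I.free σ d := Finset.mem_sdiff.2 ⟨hp, hpA⟩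
      simp [hf] at this
    · exact h.2 hr d hd φ' hφ'
  · obtain ⟨hq, hqA, hA⟩ := mem_supp_of_free hf
    have hupd : ∀ p ∈ σ.A, ∀ w, Function.update σ.φ q w p = σ.φ p := by
      intro p hp w
      rw [Function.update_of_ne]
      rintro rfl; exact hqA hp
    have hsub : σ.A ⊆ (I.unitStep σ c q).A := by
      rw [unitStep]; dsimp only; split_ifs
      · rfl
      · exact Finset.subset_insert _ _
    constructor
    · intro p hp
      by_cases hpA : p ∈ σ.A
      · simp only [unitStep, hupd p hpA]
        exact h.1 p hpA
      · rw [unitStep] at hp ⊢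
        dsimp only at hp ⊢
        split_ifs at hp with hz
        · exact absurd hp hpA
        · have hpq : p = q := (Finset.mem_insert.1 hp).resolve_right hpA
          subst hpq
          rw [Function.update_self]
          intro h0
          exact hz ⟨by simpa using congrFun h0 1, by simpa using congrFun h0 0⟩
    · intro _ d hd φ' hφ'
      rcases Finset.mem_insert.1 hd with rfl | hd
      · have hφ'A : ∀ p ∈ σ.A, φ' p = σ.φ p := fun p hp =>
          (hφ' p (hsub hp)).trans (hupd p hp _)
        have heq : (I.clause d).pairing φ' =
            (I.clause d).pairing (Function.update σ.φ q (φ' q)) := by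
          refine (I.clause d).pairing_congr fun p hp => ?_
          by_cases hpq : p = q
          · subst hpq; simp
          · rw [Function.update_of_ne hpq]
            exact hφ'A p (hA p hp hpq)
        rw [heq, (I.clause d).pairing_update hq]
        change φ' q 0 * I.form σ d q 0 + φ' q 1 * I.form σ d q 1 = 0
        by_cases hz : I.form σ d q 0 = 0 ∧ I.form σ d q 1 = 0
        · rw [hz.1, hz.2]; ring
        · have hqA' : q ∈ (I.unitStep σ d q).A := by
            simp only [unitStep, if_neg hz, Finset.mem_insert_self]
          rw [hφ' q hqA']
          simp [unitStep]
          ring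
      · exact h.2 hr d hd φ' fun p hp => (hφ' p (hsub hp)).trans (hupd p hp _)

theorem Forced.step (h : I.Forced σ) : I.Forced (I.step σ c) := by
  intro ψ hψ
  obtain ⟨hA, hr⟩ := h ψ hψ
  rcases step_cases σ c with ⟨_, h'⟩ | ⟨_, hc, hf, h'⟩ | ⟨_, hc, q, hf, h'⟩ <;> rw [h']
  · exact ⟨hA, hr⟩
  -- The residual is the factor by which the clause multiplies the nonzero vector `ψ`.
  · refine ⟨hA, ?_⟩
    have hx : ∃ x, ψ x ≠ 0 := by
      by_contra! h0
      have := hψ.1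
      simp [IsState, h0] at this
    obtain ⟨x, hx⟩ := hx
    refine (mul_eq_zero.1 (pairing_mul_eq_zero (hψ.2 c) (fun p hp => hA p ?_) x)).resolve_right hx
    by_contra hpA
    have : p ∈ I.free σ c := Finset.mem_sdiff.2 ⟨hp, hpA⟩
    simp [hf] at this
  · obtain ⟨hq, hqA, hA'⟩ := mem_supp_of_free hf
    refine ⟨fun p hp => ?_, hr⟩
    by_cases hpq : p = q
    · subst hpq
      intro x
      have := pairing_update_eq_zero (hψ.2 c) hq (φ := σ.φ)
        (fun p' hp' => hA p' (hA' p' (Finset.mem_of_mem_erase hp') (Finset.ne_of_mem_erase hp'))) x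
      rw [(I.clause c).pairing_update hq] at this
      simp only [unitStep, Function.update_self]
      simp only [form, Matrix.cons_val_zero, Matrix.cons_val_one]
      linear_combination -this
    · have hpA : p ∈ σ.A := by
        rw [unitStep] at hp
        dsimp only at hp
        split_ifs at hp
        · exact hp
        · exact (Finset.mem_insert.1 hp).resolve_left hpq
      intro x
      simp only [unitStep, Function.update_of_ne hpq]
      exact hA p hpA x

end Instance

/-! ### Dependence on a freely chosen vector -/

/-- A linear form on `ℂ²`. -/
def IsLin (f : (Fin 2 → ℂ) → ℂ) : Prop := ∃ a b, ∀ v, f v = a * v 0 + b * v 1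

/-- A quadratic form on `ℂ²`. -/
def IsQuad (f : (Fin 2 → ℂ) → ℂ) : Prop :=
  ∃ a b c, ∀ v, f v = a * v 0 ^ 2 + b * (v 0 * v 1) + c * v 1 ^ 2

theorem IsLin.mul_const_add {f g : (Fin 2 → ℂ) → ℂ} (hf : IsLin f) (hg : IsLin g) (x y : ℂ) :
    IsLin fun v => f v * x + g v * y := by
  obtain ⟨a, b, h⟩ := hf
  obtain ⟨a', b', h'⟩ := hg
  exact ⟨a * x + a' * y, b * x + b' * y, fun v => by simp only [h, h']; ring⟩

theorem IsLin.neg {f : (Fin 2 → ℂ) → ℂ} (hf : IsLin f) : IsLin fun v => -f v := by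
  obtain ⟨a, b, h⟩ := hf
  exact ⟨-a, -b, fun v => by simp only [h]; ring⟩

theorem IsLin.mul_add_mul {f f' g g' : (Fin 2 → ℂ) → ℂ} (hf : IsLin f) (hg : IsLin g)
    (hf' : IsLin f') (hg' : IsLin g') : IsQuad fun v => f v * f' v + g v * g' v := by
  obtain ⟨a, b, h⟩ := hf
  obtain ⟨a', b', h'⟩ := hf'
  obtain ⟨c, d, hh⟩ := hg
  obtain ⟨c', d', hh'⟩ := hg'
  exact ⟨a * a' + c * c', a * b' + b * a' + c * d' + d * c', b * b' + d * d', fun v => by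
    simp only [h, h', hh, hh']; ring⟩

namespace Clause

variable {n : ℕ} (c : Clause n) {Φ : (Fin 2 → ℂ) → Fin n → Fin 2 → ℂ} {ψ : Fin n → Fin 2 → ℂ}

theorem isLin_pairing {p : Fin n} (hp : p ∈ c.supp) (hlin : ∀ b, IsLin fun v => Φ v p b)
    (hψ : ∀ v, ∀ q ∈ c.supp, q ≠ p → Φ v q = ψ q) : IsLin fun v => c.pairing (Φ v) := by
  have : ∀ v, c.pairing (Φ v) = c.pairing (Function.update ψ p (Φ v p)) := by
    intro v
    refine c.pairing_congr fun q hq => ?_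
    by_cases hqp : q = p
    · subst hqp; simp
    · rw [Function.update_of_ne hqp, hψ v q hq hqp]
  simp only [this]
  simp only [c.pairing_update hp (Φ _ p)]
  exact (hlin 0).mul_const_add (hlin 1) _ _

theorem isQuad_pairing {p p' : Fin n} (hp : p ∈ c.supp) (hp' : p' ∈ c.supp) (hne : p ≠ p')
    (hlin : ∀ b, IsLin fun v => Φ v p b) (hlin' : ∀ b, IsLin fun v => Φ v p' b)
    (hψ : ∀ v, ∀ q ∈ c.supp, q ≠ p → q ≠ p' → Φ v q = ψ q) :
    IsQuad fun v => c.pairing (Φ v) := by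
  have : ∀ v, c.pairing (Φ v) =
      c.pairing (Function.update (Function.update ψ p' (Φ v p')) p (Φ v p)) := by
    intro v
    refine c.pairing_congr fun q hq => ?_
    by_cases hqp : q = p
    · subst hqp; simp
    · rw [Function.update_of_ne hqp]
      by_cases hqp' : q = p'
      · subst hqp'; simp
      · rw [Function.update_of_ne hqp', hψ v q hq hqp hqp']
  simp only [this]
  simp only [c.pairing_update hp (Φ _ p)]
  have hL : ∀ b, IsLin fun v =>
      c.pairing (Function.update (Function.update ψ p' (Φ v p')) p (ket b)) := by
    intro b
    refine c.isLin_pairing (Φ := fun v => Function.update (Function.update ψ p' (Φ v p')) p (ket b))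
      (ψ := Function.update ψ p (ket b)) hp' ?_ ?_
    · intro b'
      simpa [Function.update_of_ne hne.symm] using hlin' b'
    · intro v q _ hq
      by_cases hqp : q = p
      · subst hqp; simp
      · simp [Function.update_of_ne hqp, Function.update_of_ne hq]
  exact (hlin 0).mul_add_mul (hlin 1) (hL 0) (hL 1)

end Clause

namespace Instance

variable {k n : ℕ} (I : Instance k n)

/-- The number of incidences between the active clauses and the qubits assigned since the
assigned set was `A₀`. -/
def load (A₀ A : Finset (Fin n)) (D : Finset (Fin I.m)) : ℕ :=
  ∑ c ∈ Dᶜ, ((I.clause c).supp ∩ (A \ A₀)).card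

variable {I} {A₀ A : Finset (Fin n)} {D₀ D : Finset (Fin I.m)} {c : Fin I.m} {q : Fin n}

theorem card_filter_mem_supp (hocc : I.occurrences q ≤ 2) :
    (Finset.univ.filter fun j => q ∈ (I.clause j).supp).card ≤ 2 := by
  simpa only [occurrences, Clause.mem_supp] using hocc

/-- Settling a clause releases its incidences. -/
theorem load_eq_add (hc : c ∉ D) :
    I.load A₀ A D = ((I.clause c).supp ∩ (A \ A₀)).card + I.load A₀ A (insert c D) := by
  rw [load, load, Finset.compl_insert]
  exact (Finset.add_sum_erase _ (fun c => ((I.clause c).supp ∩ (A \ A₀)).card)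
    (Finset.mem_compl.2 hc)).symm

theorem load_insert_le :
    I.load A₀ (insert q A) D ≤
      I.load A₀ A D + (Dᶜ.filter fun j => q ∈ (I.clause j).supp).card := by
  rw [load, load, Finset.card_filter, ← Finset.sum_add_distrib]
  refine Finset.sum_le_sum fun j _ => ?_
  split_ifs with h
  · refine (Finset.card_le_card ?_).trans (Finset.card_insert_le q _)
    intro p
    simp only [Finset.mem_inter, Finset.mem_sdiff, Finset.mem_insert]
    tauto
  · rw [add_zero]
    refine Finset.card_le_card ?_
    intro p
    simp only [Finset.mem_inter, Finset.mem_sdiff, Finset.mem_insert]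
    rintro ⟨hp, hpq | hpA, hp0⟩
    · subst hpq; exact absurd hp h
    · exact ⟨hp, hpA, hp0⟩

/-- A qubit of a processed clause lies in at most one other clause. -/
theorem load_insert_le_add_one (hocc : I.occurrences q ≤ 2) (hq : q ∈ (I.clause c).supp) :
    I.load A₀ (insert q A) (insert c D) ≤ I.load A₀ A (insert c D) + 1 := by
  refine load_insert_le.trans (Nat.add_le_add_left ?_ _)
  have h1 := card_filter_mem_supp hocc
  have h2 : ((insert c D)ᶜ.filter fun j => q ∈ (I.clause j).supp) ⊆
      (Finset.univ.filter fun j => q ∈ (I.clause j).supp).erase c := by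
    intro j
    simp only [Finset.mem_filter, Finset.mem_compl, Finset.mem_insert, Finset.mem_erase,
      Finset.mem_univ, true_and]
    tauto
  have h3 := Finset.card_le_card h2
  rw [Finset.card_erase_of_mem (by simpa using hq)] at h3
  omega

theorem two_le_card_of_subset (h2 : 2 ≤ ((I.clause c).supp \ A₀).card)
    (h : (I.clause c).supp \ A = ∅) : 2 ≤ ((I.clause c).supp ∩ (A \ A₀)).card := by
  refine h2.trans (Finset.card_le_card fun p => ?_)
  have := Finset.sdiff_eq_empty_iff_subset.1 h
  simp only [Finset.mem_inter, Finset.mem_sdiff]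
  exact fun hp => ⟨hp.1, this hp.1, hp.2⟩

theorem one_le_card_of_subset (h2 : 2 ≤ ((I.clause c).supp \ A₀).card)
    (h : (I.clause c).supp \ A = {q}) : 1 ≤ ((I.clause c).supp ∩ (A \ A₀)).card := by
  have : (I.clause c).supp \ A₀ ⊆ insert q ((I.clause c).supp ∩ (A \ A₀)) := by
    intro p
    simp only [Finset.mem_inter, Finset.mem_sdiff, Finset.mem_insert]
    rintro ⟨hp, hp0⟩
    by_cases hpA : p ∈ A
    · exact Or.inr ⟨hp, hpA, hp0⟩
    · have : p ∈ (I.clause c).supp \ A := Finset.mem_sdiff.2 ⟨hp, hpA⟩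
      rw [h] at this
      exact Or.inl (Finset.mem_singleton.1 this)
  have h3 := Finset.card_le_card this
  have h4 := Finset.card_insert_le q ((I.clause c).supp ∩ (A \ A₀))
  omega

variable (I) in
/-- The load is at most one: from such a state no violation can arise, as each active clause had
at least two free qubits at the start. -/
structure Safe (A₀ : Finset (Fin n)) (D₀ : Finset (Fin I.m)) (σ : State n I.m) : Prop where
  r : σ.r = 0
  D : D₀ ⊆ σ.D
  load : I.load A₀ σ.A σ.D ≤ 1

theorem Safe.step (hocc : ∀ q, I.occurrences q ≤ 2)
    (h₀ : ∀ c ∉ D₀, 2 ≤ ((I.clause c).supp \ A₀).card) {σ : State n I.m}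
    (h : I.Safe A₀ D₀ σ) : I.Safe A₀ D₀ (I.step σ c) := by
  rcases step_cases σ c with ⟨_, h'⟩ | ⟨_, hc, hf, h'⟩ | ⟨_, hc, q, hf, h'⟩ <;> rw [h']
  · exact h
  · have h1 := load_eq_add (A₀ := A₀) (A := σ.A) hc
    have h2 := two_le_card_of_subset (h₀ c fun hc' => hc (h.D hc')) hf
    have := h.load
    omega
  · have h1 := load_eq_add (A₀ := A₀) (A := σ.A) hc
    have h2 := one_le_card_of_subset (h₀ c fun hc' => hc (h.D hc')) hf
    have h3 := h.load
    refine ⟨h.r, h.D.trans (Finset.subset_insert _ _), ?_⟩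
    rw [unitStep]
    dsimp only
    split_ifs
    · omega
    · have := load_insert_le_add_one (A₀ := A₀) (A := σ.A) (D := σ.D) (hocc q)
        (mem_supp_of_free hf).1
      omega

/-- The state `σ`, reached from the choice of the vector `v`, has assigned set `A` and processed
set `D`, and its vectors depend on `v` by the functions `g`. -/
structure Follows (A : Finset (Fin n)) (D : Finset (Fin I.m))
    (g : Fin n → Fin 2 → (Fin 2 → ℂ) → ℂ) (v : Fin 2 → ℂ) (σ : State n I.m) : Prop where
  r : σ.r = 0
  eqA : σ.A = A
  eqD : σ.D = D
  φ : ∀ p ∈ A, ∀ b, σ.φ p b = g p b v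

variable (I) in
/-- For a family of states indexed by the vector chosen for one qubit: apart from the safe ones,
they all proceed in the same way, with vectors that depend linearly on the chosen one; or
they have all failed, with a residual that is a quadratic form of the chosen vector. -/
def Lockstep (A₀ : Finset (Fin n)) (D₀ : Finset (Fin I.m)) (φ₀ : Fin n → Fin 2 → ℂ)
    (S : (Fin 2 → ℂ) → State n I.m) : Prop :=
  (∃ A D g, A₀ ⊆ A ∧ D₀ ⊆ D ∧ I.load A₀ A D ≤ 2 ∧ (∀ p ∈ A \ A₀, ∀ b, IsLin (g p b)) ∧
    (∀ p ∈ A₀, ∀ b v, g p b v = φ₀ p b) ∧ ∀ v, I.Safe A₀ D₀ (S v) ∨ Follows A D g v (S v)) ∨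
  (∃ Q, IsQuad Q ∧ ∀ v, I.Safe A₀ D₀ (S v) ∨ ((S v).r ≠ 0 ∧ (S v).r = Q v))

theorem Lockstep.step (hocc : ∀ q, I.occurrences q ≤ 2)
    (h₀ : ∀ c ∉ D₀, 2 ≤ ((I.clause c).supp \ A₀).card) {φ₀ : Fin n → Fin 2 → ℂ}
    {S : (Fin 2 → ℂ) → State n I.m} (h : I.Lockstep A₀ D₀ φ₀ S) (c : Fin I.m) :
    I.Lockstep A₀ D₀ φ₀ fun v => I.step (S v) c := by
  rcases h with ⟨A, D, g, hA₀, hD, hload, hlin, hg, hS⟩ | ⟨Q, hQ, hS⟩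
  swap
  · refine Or.inr ⟨Q, hQ, fun v => (hS v).imp (fun h => h.step hocc h₀) fun h => ?_⟩
    simp only [step_of_skip (Or.inl h.1)]
    exact h
  have hrest : ∀ p ∈ A, ∀ b v, p ∉ A \ A₀ → g p b v = φ₀ p b := by
    intro p hpA b v hp
    refine hg p ?_ b v
    by_contra hp0
    exact hp (Finset.mem_sdiff.2 ⟨hpA, hp0⟩)
  by_cases hskip : c ∈ D ∨ 2 ≤ ((I.clause c).supp \ A).card
  · refine Or.inl ⟨A, D, g, hA₀, hD, hload, hlin, hg, fun v => (hS v).imp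
      (fun h => h.step hocc h₀) fun h => ?_⟩
    have : I.step (S v) c = S v := by
      rcases hskip with hc | hc
      · exact step_of_skip (Or.inr (h.eqD ▸ hc))
      · exact step_of_two_le (by rw [free, h.eqA]; exact hc)
    simpa only [this] using h
  push Not at hskip
  obtain ⟨hc, hcard⟩ := hskip
  have hc₀ := h₀ c fun h => hc (hD h)
  have hsum := load_eq_add (A₀ := A₀) (A := A) hc
  obtain h0 | h1 : ((I.clause c).supp \ A).card = 0 ∨ ((I.clause c).supp \ A).card = 1 := by omega
  -- No free qubit: the residual is bilinear in the vectors of the two new qubits of `c`.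
  · rw [Finset.card_eq_zero] at h0
    have hsub := Finset.sdiff_eq_empty_iff_subset.1 h0
    have h2 := two_le_card_of_subset hc₀ h0
    obtain ⟨p, p', hne, hpp⟩ := Finset.card_eq_two.1
      (show ((I.clause c).supp ∩ (A \ A₀)).card = 2 by omega)
    have hp : p ∈ (I.clause c).supp ∩ (A \ A₀) := by simp [hpp]
    have hp' : p' ∈ (I.clause c).supp ∩ (A \ A₀) := by simp [hpp]
    rw [Finset.mem_inter] at hp hp'
    refine Or.inr ⟨fun v => (I.clause c).pairing fun p b => g p b v, ?_, fun v => ?_⟩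
    · refine (I.clause c).isQuad_pairing (ψ := φ₀) hp.1 hp'.1 hne (hlin p hp.2) (hlin p' hp'.2) ?_
      intro v q hq hqp hqp'
      funext b
      refine hrest q (hsub hq) b v fun hqA => ?_
      have : q ∈ (I.clause c).supp ∩ (A \ A₀) := Finset.mem_inter.2 ⟨hq, hqA⟩
      simp [hpp, hqp, hqp'] at this
    · rcases hS v with h | h
      · exact Or.inl (h.step hocc h₀)
      · simp only
        rw [step_of_free_empty h.r (h.eqD ▸ hc) (by rw [free, h.eqA, h0])]
        have hr : (I.clause c).pairing (S v).φ = (I.clause c).pairing fun p b => g p b v :=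
          (I.clause c).pairing_congr fun q hq => funext fun b => h.φ q (hsub hq) b
        by_cases hz : (I.clause c).pairing (S v).φ = 0
        · refine Or.inl ⟨hz, ?_, ?_⟩
          · exact (h.eqD ▸ hD).trans (Finset.subset_insert _ _)
          · simp only [h.eqA, h.eqD]; omega
        · exact Or.inr ⟨hz, hr⟩
  -- One free qubit `q`, which gets a vector linear in that of the only new qubit `p` of `c`.
  · obtain ⟨q, hq⟩ := Finset.card_eq_one.1 h1
    have h1 := one_le_card_of_subset hc₀ hq
    have hqs : q ∈ (I.clause c).supp \ A := by simp [hq]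
    rw [Finset.mem_sdiff] at hqs
    have hA : ∀ p ∈ (I.clause c).supp, p ≠ q → p ∈ A := by
      intro p hp hpq
      by_contra hpA
      have : p ∈ (I.clause c).supp \ A := Finset.mem_sdiff.2 ⟨hp, hpA⟩
      simp [hq, hpq] at this
    have hins := load_insert_le_add_one (A₀ := A₀) (A := A) (D := D) (hocc q) hqs.1
    have hstep : ∀ v, Follows A D g v (S v) → I.step (S v) c = I.unitStep (S v) c q :=
      fun v h => step_of_free_singleton h.r (h.eqD ▸ hc) (by rw [free, h.eqA, hq])
    by_cases h2 : 2 ≤ ((I.clause c).supp ∩ (A \ A₀)).card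
    -- Both sides of the propagation have met in `c`, so that all states become safe.
    · refine Or.inr ⟨0, ⟨0, 0, 0, fun v => by simp⟩, fun v => Or.inl ?_⟩
      rcases hS v with h | h
      · exact h.step hocc h₀
      · simp only [hstep v h]
        refine ⟨h.r, (h.eqD ▸ hD).trans (Finset.subset_insert _ _), ?_⟩
        simp only [unitStep, h.eqA, h.eqD]
        split_ifs <;> omega
    obtain ⟨p, hp⟩ := Finset.card_eq_one.1
      (show ((I.clause c).supp ∩ (A \ A₀)).card = 1 by omega)
    have hps : p ∈ (I.clause c).supp ∩ (A \ A₀) := by simp [hp]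
    rw [Finset.mem_inter] at hps
    have hpA := (Finset.mem_sdiff.1 hps.2).1
    have hpq : p ≠ q := by rintro rfl; exact hqs.2 hpA
    set f : Fin 2 → (Fin 2 → ℂ) → ℂ := fun b v =>
      (I.clause c).pairing (Function.update (fun p b => g p b v) q (ket b)) with hf
    have hflin : ∀ b, IsLin (f b) := by
      intro b
      refine (I.clause c).isLin_pairing (ψ := Function.update φ₀ q (ket b)) hps.1 ?_ ?_
      · intro b'
        simpa [Function.update_of_ne hpq] using hlin p hps.2 b'
      · intro v p' hp' hpp'
        by_cases hpq' : p' = q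
        · subst hpq'; simp
        · rw [Function.update_of_ne hpq', Function.update_of_ne hpq']
          funext b'
          refine hrest p' (hA p' hp' hpq') b' v fun hpA' => ?_
          have : p' ∈ (I.clause c).supp ∩ (A \ A₀) := Finset.mem_inter.2 ⟨hp', hpA'⟩
          simp [hp, hpp'] at this
    have hform : ∀ v, Follows A D g v (S v) → ∀ b, I.form (S v) c q b = f b v := by
      intro v h b
      refine (I.clause c).pairing_congr fun p' hp' => ?_
      by_cases hpq' : p' = q
      · subst hpq'; simp
      · rw [Function.update_of_ne hpq', Function.update_of_ne hpq']
        exact funext fun b' => h.φ p' (hA p' hp' hpq') b'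
    refine Or.inl ⟨insert q A, insert c D,
      Function.update g q ![fun v => -f 1 v, fun v => f 0 v],
      hA₀.trans (Finset.subset_insert _ _), hD.trans (Finset.subset_insert _ _), by omega,
      ?_, ?_, fun v => ?_⟩
    · intro p' hp' b
      by_cases hpq' : p' = q
      · subst hpq'
        rw [Function.update_self]
        fin_cases b
        · exact (hflin 1).neg
        · exact hflin 0
      · rw [Function.update_of_ne hpq']
        refine hlin p' ?_ b
        simpa [hpq'] using hp'
    · intro p' hp' b v
      have hpq' : p' ≠ q := by
        rintro rfl
        exact hqs.2 (hA₀ hp')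
      rw [Function.update_of_ne hpq']
      exact hg p' hp' b v
    · rcases hS v with h | h
      · exact Or.inl (h.step hocc h₀)
      simp only [hstep v h]
      by_cases hz : I.form (S v) c q 0 = 0 ∧ I.form (S v) c q 1 = 0
      -- A vanishing form releases an incidence without creating one.
      · refine Or.inl ⟨h.r, (h.eqD ▸ hD).trans (Finset.subset_insert _ _), ?_⟩
        simp only [unitStep, h.eqA, h.eqD, if_pos hz]
        omega
      · refine Or.inr ⟨h.r, ?_, ?_, ?_⟩
        · simp only [unitStep, h.eqA, if_neg hz]
        · simp only [unitStep, h.eqD]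
        · intro p' hp' b
          by_cases hpq' : p' = q
          · subst hpq'
            simp only [unitStep, Function.update_self, hform v h]
            fin_cases b <;> simp
          · simp only [unitStep, Function.update_of_ne hpq']
            exact h.φ p' ((Finset.mem_insert.1 hp').resolve_left hpq') b

/-- If propagation from a stable state is restarted with a vector `v` on a free qubit, the
residual vanishes or is the value at `v` of a quadratic form that is the same for all `v`. -/
theorem exists_isQuad (hocc : ∀ q, I.occurrences q ≤ 2) {σ : State n I.m} (hst : I.Stable σ)
    (hr : σ.r = 0) (hq : q ∉ σ.A) : ∃ Q, IsQuad Q ∧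
      ∀ v, (I.propagate (σ.assign q v)).r = 0 ∨ (I.propagate (σ.assign q v)).r = Q v := by
  have h₀ : ∀ c ∉ σ.D, 2 ≤ ((I.clause c).supp \ σ.A).card := hst hr
  have hstart : I.Lockstep σ.A σ.D σ.φ fun v => σ.assign q v := by
    refine Or.inl ⟨insert q σ.A, σ.D,
      fun p b v => Function.update σ.φ q v p b, Finset.subset_insert _ _, subset_rfl,
      ?_, ?_, ?_, fun v => Or.inr ?_⟩
    · refine load_insert_le.trans ?_
      have h1 : I.load σ.A σ.A σ.D = 0 := by simp [load]
      rw [h1, zero_add]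
      exact (Finset.card_le_card (Finset.filter_subset_filter _ (Finset.subset_univ _))).trans
        (card_filter_mem_supp (hocc q))
    · intro p hp b
      have : p = q := by
        rw [Finset.mem_sdiff, Finset.mem_insert] at hp
        tauto
      subst this
      simp only [Function.update_self]
      fin_cases b
      · exact ⟨1, 0, fun v => by simp⟩
      · exact ⟨0, 1, fun v => by simp⟩
    · intro p hp b v
      have hpq : p ≠ q := by rintro rfl; exact hq hp
      simp only [Function.update_of_ne hpq]
    · exact ⟨hr, rfl, rfl, fun p _ b => rfl⟩
  have hfold : ∀ (l : List (Fin I.m)) (S : (Fin 2 → ℂ) → State n I.m),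
      I.Lockstep σ.A σ.D σ.φ S → I.Lockstep σ.A σ.D σ.φ fun v => l.foldl I.step (S v) := by
    intro l
    induction l with
    | nil => exact fun S h => h
    | cons c l ih => exact fun S h => ih _ (h.step hocc h₀ c)
  have hiter : ∀ t, I.Lockstep σ.A σ.D σ.φ fun v => I.sweep^[t] (σ.assign q v) := by
    intro t
    induction t with
    | zero => exact hstart
    | succ t ih =>
      simp only [Function.iterate_succ_apply']
      exact hfold _ _ ih
  rcases hiter I.m with ⟨A, D, g, -, -, -, -, -, h⟩ | ⟨Q, hQ, h⟩
  · refine ⟨0, ⟨0, 0, 0, fun v => by simp⟩, fun v => Or.inl ?_⟩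
    exact (h v).elim (fun h => h.r) fun h => h.r
  · exact ⟨Q, hQ, fun v => (h v).imp (fun h => h.r) fun h => h.2⟩

end Instance

/-! ### Evaluation of a clause by successive contraction -/

/-- Contraction of the tensor with entry `W (∑ i, y i * 2 ^ i)` at `y` with the vectors
`v 0, …, v (k - 1)`. -/
def contraction (k : ℕ) (W : ℕ → ℂ) (v : ℕ → Fin 2 → ℂ) : ℂ :=
  ∑ y : Fin k → Fin 2, W (∑ i, (y i : ℕ) * 2 ^ (i : ℕ)) * ∏ i : Fin k, v i (y i)

theorem contraction_zero (W : ℕ → ℂ) (v : ℕ → Fin 2 → ℂ) : contraction 0 W v = W 0 := by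
  simp [contraction]

theorem digits_lt {k : ℕ} (y : Fin k → Fin 2) : ∑ i, (y i : ℕ) * 2 ^ (i : ℕ) < 2 ^ k := by
  rw [← finFunctionFinEquiv_apply]
  exact (finFunctionFinEquiv y).isLt

theorem contraction_congr {k : ℕ} {W W' : ℕ → ℂ} (v : ℕ → Fin 2 → ℂ)
    (h : ∀ l < 2 ^ k, W l = W' l) : contraction k W v = contraction k W' v := by
  unfold contraction
  exact Finset.sum_congr rfl fun y _ => by rw [h _ (digits_lt y)]

/-- The least significant index can be contracted first. -/
theorem contraction_succ (k : ℕ) (W : ℕ → ℂ) (v : ℕ → Fin 2 → ℂ) :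
    contraction (k + 1) W v =
      contraction k (fun l => W (l + l) * v 0 0 + W (l + l + 1) * v 0 1) fun j => v (j + 1) := by
  unfold contraction
  rw [← (Fin.consEquiv fun _ : Fin (k + 1) => Fin 2).sum_comp, Fintype.sum_prod_type_right]
  refine Finset.sum_congr rfl fun y _ => ?_
  have hsum : ∀ b : Fin 2, ∑ i : Fin (k + 1),
      ((Fin.cons b y : Fin (k + 1) → Fin 2) i : ℕ) * 2 ^ (i : ℕ) =
      (∑ i, (y i : ℕ) * 2 ^ (i : ℕ)) + (∑ i, (y i : ℕ) * 2 ^ (i : ℕ)) + b := by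
    intro b
    rw [Fin.sum_univ_succ, ← two_mul, Finset.mul_sum]
    simp only [Fin.cons_zero, Fin.cons_succ, Fin.val_zero, Fin.val_succ, pow_zero, mul_one]
    rw [add_comm]
    congr 1
    exact Finset.sum_congr rfl fun i _ => by ring
  have hprod : ∀ b : Fin 2, ∏ i : Fin (k + 1), v i ((Fin.cons b y : Fin (k + 1) → Fin 2) i) =
      v 0 b * ∏ i : Fin k, v (i + 1) (y i) := by
    intro b
    rw [Fin.prod_univ_succ]
    simp
  simp only [Fin.consEquiv, Equiv.coe_fn_mk, hsum, hprod, Fin.sum_univ_two]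
  simp
  ring

theorem Clause.pairing_eq_contraction {n : ℕ} (c : Clause n) (φ : Fin n → Fin 2 → ℂ) {W : ℕ → ℂ}
    {v : ℕ → Fin 2 → ℂ}
    (hW : ∀ l : Fin (2 ^ c.loc), W l = star (c.amp (finFunctionFinEquiv.symm l)))
    (hv : ∀ i : Fin c.loc, v i = φ (c.qubit i)) : c.pairing φ = contraction c.loc W v := by
  unfold pairing contraction
  refine Finset.sum_congr rfl fun y _ => ?_
  rw [← finFunctionFinEquiv_apply, hW, Equiv.symm_apply_apply]
  simp only [hv]

/-! ### Programs for single clauses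

Natural arrays `4`, `5` and `6` hold, for each clause, the positions of its qubits and of its
amplitudes in the input and the number of its amplitudes. Arrays `7` and `8` flag the assigned
qubits and the processed clauses, `9` and `10` hold copies of them, and complex array `1` holds the
vectors of the qubits. The residual is in complex array `3`, and `2` is the work space for
contractions. The natural arrays from `11` on hold one number each: `11` to `15` are loop
counters, with the current clause in `13` and the current qubit in `15`; `16` and `17` belong to the
count of free qubits, `18` holds `n + m`, and `19` and `20` are used to compute the positions. Complex
array `4` holds the linear form of a unit clause, and later the norm of a vector; `6` holds the
residuals of the trials. -/

attribute [local simp] NExp.eval CExp.eval Test.Holds Memory.writeNat_nat Memory.writeCpx_cpx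
  Memory.writeNat_cpx Memory.writeCpx_nat Memory.writeNat_nat_of_ne Memory.writeCpx_cpx_of_ne

@[simp] theorem NExp.eval_writeCpx (e : NExp) (s : Memory) (a i : ℕ) (z : ℂ) :
    e.eval (s.writeCpx a i z) = e.eval s := by
  induction e with
  | lit v => rfl
  | get b e ih => simp [ih]
  | add e f ihe ihf => simp [ihe, ihf]
  | sub e f ihe ihf => simp [ihe, ihf]

/-- The memory holds the input and the table of positions of the clauses. -/
structure Loaded {k n : ℕ} (I : Instance k n) (s : Memory) : Prop where
  n : s.nat 0 0 = n
  m : s.nat 0 1 = I.m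
  loc : ∀ j : Fin I.m, s.nat 1 j = (I.clause j).loc
  qubit : ∀ (j : Fin I.m) (i : Fin (I.clause j).loc),
    s.nat 2 (s.nat 4 j + i) = (I.clause j).qubit i
  amp : ∀ (j : Fin I.m) (l : Fin (2 ^ (I.clause j).loc)),
    s.cpx 0 (s.nat 5 j + l) = (I.clause j).amp (finFunctionFinEquiv.symm l)
  pow : ∀ j : Fin I.m, s.nat 6 j = 2 ^ (I.clause j).loc

theorem Loaded.congr {k n : ℕ} {I : Instance k n} {s u : Memory} (h : Loaded I s)
    (hn : ∀ a ∈ [0, 1, 2, 4, 5, 6], u.nat a = s.nat a) (hc : u.cpx 0 = s.cpx 0) :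
    Loaded I u := by
  simp only [List.forall_mem_cons] at hn
  obtain ⟨h0, h1, h2, h4, h5, h6, -⟩ := hn
  exact ⟨h0 ▸ h.n, h0 ▸ h.m, h1 ▸ h.loc, h2 ▸ h4 ▸ h.qubit, hc ▸ h5 ▸ h.amp, h6 ▸ h.pow⟩

theorem Loaded.frame {k n : ℕ} {I : Instance k n} {s u : Memory} {P : Program} (h : Loaded I s)
    (hF : Frame P s u) (hn : ∀ a ∈ [0, 1, 2, 4, 5, 6], P.writesNat a = false)
    (hc : P.writesCpx 0 = false) : Loaded I u :=
  h.congr (fun a ha => hF.nat a (hn a ha)) (hF.cpx 0 hc)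

namespace Instance

variable {k n : ℕ} (I : Instance k n)

theorem n_add_m_le_size : n + I.m ≤ I.size := Nat.le_add_right _ _

theorem loc_add_pow_le_size (c : Fin I.m) :
    (I.clause c).loc + 2 ^ (I.clause c).loc ≤ I.size := by
  refine le_trans ?_ (Nat.le_add_left _ _)
  exact Finset.single_le_sum (f := fun j => (I.clause j).loc + 2 ^ (I.clause j).loc)
    (fun _ _ => Nat.zero_le _) (Finset.mem_univ c)

end Instance

namespace Program

/-- The qubit at the current position of the current clause. -/
abbrev curQubit : NExp := .get 2 (.add (.get 4 (.var 13)) (.var 12))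

/-- Compute the scalar product of the current clause with the vectors of its qubits. Each pass of the
second loop contracts the least significant index, in place; as only `+` is available to shorten the
tensor, it is applied to all cells, and those beyond the shortened tensor hold garbage. -/
def contract : Program :=
  .seq
    (.forTo 11 (.get 6 (.var 13))
      (.setCpx 2 (.var 11) (.conj (.get 0 (.add (.get 5 (.var 13)) (.var 11))))))
    (.forTo 12 (.get 1 (.var 13))
      (.forTo 11 (.get 6 (.var 13))
        (.setCpx 2 (.var 11)
          (.add (.mul (.get 2 (.add (.var 11) (.var 11))) (.get 1 (.add curQubit curQubit)))
            (.mul (.get 2 (.add (.add (.var 11) (.var 11)) (.lit 1)))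
              (.get 1 (.add (.add curQubit curQubit) (.lit 1))))))))

/-- Count the free qubits of the current clause, and note the last one. -/
def countFree : Program :=
  .seq (.setNat 16 (.lit 0) (.lit 0))
    (.forTo 12 (.get 1 (.var 13))
      (.ite (.le (.get 7 curQubit) (.lit 0))
        (.seq (.setNat 16 (.lit 0) (.add (.var 16) (.lit 1))) (.setNat 17 (.lit 0) curQubit))
        .skip))

/-- Give to the qubit `e` the vector `(x, y)`. -/
def setVec (e : NExp) (x y : CExp) : Program :=
  .seq (.setCpx 1 (.add e e) x) (.setCpx 1 (.add (.add e e) (.lit 1)) y)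

end Program

section

variable {k n N : ℕ} {I : Instance k n} {s : Memory} {c : Fin I.m}

theorem wp_contract (hN : I.size ≤ N) (hs : Loaded I s) (hc : s.nat 13 0 = c) :
    Wp N .contract s fun u => u.cpx 2 0 = (I.clause c).pairing s.output := by
  have hloc := (Nat.le_add_right _ _).trans ((I.loc_add_pow_le_size c).trans hN)
  have hpow := (Nat.le_add_left _ _).trans ((I.loc_add_pow_le_size c).trans hN)
  set v : ℕ → Fin 2 → ℂ := fun i b => s.cpx 1 (2 * s.nat 2 (s.nat 4 c + i) + b) with hv
  refine Wp.seq ?_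
  refine Wp.forTo (n := 2 ^ (I.clause c).loc)
    (fun j u => ∀ l < j, u.cpx 2 l = star (s.cpx 0 (s.nat 5 c + l))) rfl hpow ?_ ?_ ?_ ?_ ?_
  · intro u hF
    simp [hF.nat 13 rfl, hF.nat 6 rfl, hc, hs.pow]
  · intro j u v h; simpa using h
  · intro l hl; omega
  · intro j u hj hF hk h
    refine Wp.setCpx fun l hl => ?_
    by_cases hlj : l = j
    · simp [hlj, hk, hF.nat 13 rfl, hF.nat 5 rfl, hF.cpx 0 rfl, hc]
    · simp [hlj, hk, h l (by omega)]
  intro u hFu hu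
  refine Wp.forTo (n := (I.clause c).loc)
    (fun i w => contraction ((I.clause c).loc - i) (w.cpx 2) (fun j => v (j + i)) =
      (I.clause c).pairing s.output)
    rfl hloc ?_ ?_ ?_ ?_ ?_
  · intro w hF
    simp [hF.nat 13 rfl, hF.nat 1 rfl, hFu.nat 13 rfl, hFu.nat 1 rfl, hc, hs.loc]
  · intro j u v h; simpa using h
  · refine ((I.clause c).pairing_eq_contraction s.output ?_ ?_).symm
    · intro l
      rw [hu l l.isLt, hs.amp]
    · intro i
      funext b
      simp only [hv, Memory.output, add_zero, hs.qubit]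
  · intro i w hi hFw hk h
    refine Wp.forTo (n := 2 ^ (I.clause c).loc) (fun j w' => ∀ l, w'.cpx 2 l =
      if l < j then w.cpx 2 (l + l) * v i 0 + w.cpx 2 (l + l + 1) * v i 1 else w.cpx 2 l)
      rfl hpow ?_ ?_ ?_ ?_ ?_
    · intro w' hF
      simp [hF.nat 13 rfl, hF.nat 6 rfl, hFw.nat 13 rfl, hFw.nat 6 rfl, hFu.nat 13 rfl,
        hFu.nat 6 rfl, hc, hs.pow]
    · intro j u v h; simpa using h
    · simp
    · intro j w' hj hF hk' h'
      refine Wp.setCpx fun l => ?_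
      have e13 : w'.nat 13 0 = c := by
        rw [hF.nat 13 rfl, hFw.nat 13 rfl, hFu.nat 13 rfl, hc]
      have e12 : w'.nat 12 0 = i := by rw [hF.nat 12 rfl, hk]
      have e4 : w'.nat 4 = s.nat 4 := by rw [hF.nat 4 rfl, hFw.nat 4 rfl, hFu.nat 4 rfl]
      have e2 : w'.nat 2 = s.nat 2 := by rw [hF.nat 2 rfl, hFw.nat 2 rfl, hFu.nat 2 rfl]
      have e1 : w'.cpx 1 = s.cpx 1 := by rw [hF.cpx 1 rfl, hFw.cpx 1 rfl, hFu.cpx 1 rfl]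
      -- Cells `2 j` and `2 j + 1` have not been overwritten before pass `j`.
      have hlt : ¬ j + j < j := by omega
      have hlt' : ¬ j + j + 1 < j := by omega
      by_cases hlj : l = j
      · simp [hlj, hk', e13, e12, e4, e2, e1, h', hlt', hv, two_mul]
      · have : l < j + 1 ↔ l < j := by omega
        simp [hlj, hk', h', this]
    · intro w' _ h'
      rw [← h, show (I.clause c).loc - i = ((I.clause c).loc - (i + 1)) + 1 by omega, contraction_succ]
      have hsh : (fun j => v (j + (i + 1))) = fun j => v (j + 1 + i) := by
        funext j; rw [show j + (i + 1) = j + 1 + i by omega]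
      rw [hsh]
      refine contraction_congr _ fun l hl => ?_
      have : (2 : ℕ) ^ ((I.clause c).loc - (i + 1)) ≤ 2 ^ (I.clause c).loc :=
        Nat.pow_le_pow_right (by norm_num) (by omega)
      rw [h', if_pos (by omega), zero_add]
  · intro w _ h
    rw [← h, Nat.sub_self, contraction_zero]

theorem wp_setVec {e : NExp} {x y : CExp} {q : Fin n} (he : e.eval s = q)
    (hy : y.eval (s.writeCpx 1 (q + q) (x.eval s)) = y.eval s) :
    Wp N (.setVec e x y) s fun u =>
      (u.output : Fin n → Fin 2 → ℂ) = Function.update s.output q ![x.eval s, y.eval s] := by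
  refine Wp.seq (Wp.setCpx (Wp.setCpx ?_))
  funext p b
  by_cases hpq : p = q
  · subst hpq
    fin_cases b
    · simp [Memory.output, he, two_mul]
    · simp [Memory.output, he, hy, two_mul]
  · have hne : (p : ℕ) ≠ q := fun h => hpq (Fin.ext h)
    have h1 : 2 * (p : ℕ) + (b : ℕ) ≠ q + q := by omega
    have h2 : 2 * (p : ℕ) + (b : ℕ) ≠ q + q + 1 := by omega
    simp [Memory.output, he, Function.update_of_ne hpq, h1, h2]

theorem wp_countFree {σ : State n I.m} (hN : I.size ≤ N) (hs : Loaded I s)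
    (hc : s.nat 13 0 = c) (hA : ∀ q : Fin n, s.nat 7 q = 0 ↔ q ∉ σ.A) :
    Wp N .countFree s fun u => u.nat 16 0 = (I.free σ c).card ∧
      ((I.free σ c).Nonempty → ∃ q ∈ I.free σ c, u.nat 17 0 = q) := by
  have hloc := (Nat.le_add_right _ _).trans ((I.loc_add_pow_le_size c).trans hN)
  let T : ℕ → Finset (Fin n) := fun j =>
    ((Finset.univ.filter fun i : Fin (I.clause c).loc => (i : ℕ) < j).map (I.clause c).qubit) \ σ.A
  have hT : ∀ i : Fin (I.clause c).loc, T (i + 1) =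
      if (I.clause c).qubit i ∈ σ.A then T i else insert ((I.clause c).qubit i) (T i) := by
    intro i
    have : (Finset.univ.filter fun i' : Fin (I.clause c).loc => (i' : ℕ) < i + 1) =
        insert i (Finset.univ.filter fun i' : Fin (I.clause c).loc => (i' : ℕ) < i) := by
      ext i'
      simp only [Finset.mem_filter, Finset.mem_univ, true_and, Finset.mem_insert, Fin.ext_iff]
      omega
    simp only [T, this, Finset.map_insert]
    split_ifs with h
    · rw [Finset.insert_sdiff_of_mem _ h]
    · rw [Finset.insert_sdiff_of_notMem _ h]
  have hnot : ∀ i : Fin (I.clause c).loc, (I.clause c).qubit i ∉ T i := by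
    intro i
    simp [T]
  refine Wp.seq (Wp.setNat ?_)
  refine Wp.forTo (n := (I.clause c).loc) (fun j u => u.nat 16 0 = (T j).card ∧
    ((T j).Nonempty → ∃ q ∈ T j, u.nat 17 0 = q)) rfl hloc ?_ ?_ ?_ ?_ ?_
  · intro u hF
    simp [hF.nat 13 rfl, hF.nat 1 rfl, hc, hs.loc]
  · intro j u v h; simpa using h
  · simp [T]
  · intro j u hj hF hk h
    have e13 : u.nat 13 0 = c := by rw [hF.nat 13 rfl]; simpa using hc
    have eq : u.nat 2 (u.nat 4 c + j) = (I.clause c).qubit ⟨j, hj⟩ := by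
      rw [hF.nat 2 rfl, hF.nat 4 rfl]
      simpa using hs.qubit c ⟨j, hj⟩
    have e7 : ∀ q : Fin n, u.nat 7 q = 0 ↔ q ∉ σ.A := by
      intro q
      rw [hF.nat 7 rfl]; simpa using hA q
    have hTj := hT ⟨j, hj⟩
    have hnj := hnot ⟨j, hj⟩
    simp only at hTj hnj
    refine Wp.ite (fun hb => ?_) fun hb => ?_
    · simp only [Test.Holds, NExp.eval, e13, hk, eq, Nat.le_zero, e7] at hb
      rw [if_neg hb] at hTj
      refine Wp.seq (Wp.setNat (Wp.setNat ?_))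
      rw [hTj, Finset.card_insert_of_notMem hnj]
      refine ⟨by simp [h.1], fun _ => ⟨_, Finset.mem_insert_self _ _, ?_⟩⟩
      simp [e13, hk, eq]
    · simp only [Test.Holds, NExp.eval, e13, hk, eq, Nat.le_zero, e7, not_not] at hb
      rw [if_pos hb] at hTj
      exact Wp.skip (by rw [hTj]; exact h)
  · intro u _ h
    have : T (I.clause c).loc = I.free σ c := by
      simp only [T, Fin.is_lt, Finset.filter_true, Instance.free, Clause.supp]
    rwa [this] at h

end

/-! ### The propagation program -/

/-- The memory holds the state `σ`. Vectors of unassigned qubits are irrelevant. -/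
structure Represents {k n : ℕ} (I : Instance k n) (σ : State n I.m) (s : Memory) : Prop where
  loaded : Loaded I s
  A : ∀ q : Fin n, s.nat 7 q = 0 ↔ q ∉ σ.A
  D : ∀ c : Fin I.m, s.nat 8 c = 0 ↔ c ∉ σ.D
  φ : ∀ q ∈ σ.A, s.output q = σ.φ q
  r : s.cpx 3 0 = σ.r

theorem Represents.congr {k n : ℕ} {I : Instance k n} {σ : State n I.m} {s u : Memory}
    (h : Represents I σ s) (hn : ∀ a ∈ [0, 1, 2, 4, 5, 6, 7, 8], u.nat a = s.nat a)
    (hc : ∀ a ∈ [0, 1, 3], u.cpx a = s.cpx a) : Represents I σ u := by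
  refine ⟨h.loaded.congr (fun a ha => hn a ?_) (hc 0 (by simp)), ?_, ?_, ?_, ?_⟩
  · simp only [List.mem_cons, List.not_mem_nil] at ha ⊢; tauto
  · rw [hn 7 (by simp)]; exact h.A
  · rw [hn 8 (by simp)]; exact h.D
  · intro q hq
    rw [← h.φ q hq]
    funext b
    simp only [Memory.output, hc 1 (by simp)]
  · rw [hc 3 (by simp)]; exact h.r

namespace Program

/-- The effect of `Instance.unitStep` on the current clause and its free qubit, which is in
natural array `17`. -/
def unitStep : Program :=
  .seq (.setNat 8 (.var 13) (.lit 1))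
  (.seq (setVec (.var 17) .one .zero)
  (.seq contract
  (.seq (.setCpx 4 (.lit 0) (.get 2 (.lit 0)))
  (.seq (setVec (.var 17) .zero .one)
  (.seq contract
  (.seq (.setCpx 4 (.lit 1) (.get 2 (.lit 0)))
  (.seq (setVec (.var 17) (.sub .zero (.get 4 (.lit 1))) (.get 4 (.lit 0)))
    (.ite (.and (.isZero (.get 4 (.lit 0))) (.isZero (.get 4 (.lit 1)))) .skip
      (.setNat 7 (.var 17) (.lit 1))))))))))

/-- The effect of `Instance.step` on the current clause. -/
def step : Program :=
  .ite (.and (.isZero (.get 3 (.lit 0))) (.le (.get 8 (.var 13)) (.lit 0)))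
    (.seq countFree
      (.ite (.le (.var 16) (.lit 0))
        (.seq contract
          (.seq (.setCpx 3 (.lit 0) (.get 2 (.lit 0))) (.setNat 8 (.var 13) (.lit 1))))
        (.ite (.le (.var 16) (.lit 1)) unitStep .skip)))
    .skip

/-- The effect of `Instance.propagate`. -/
def propagate : Program :=
  .forTo 14 (.get 0 (.lit 1)) (.forTo 13 (.get 0 (.lit 1)) step)

end Program

section

variable {k n N : ℕ} {I : Instance k n} {σ : State n I.m} {s : Memory} {c : Fin I.m} {q : Fin n}

theorem pairing_eq_form {φ : Fin n → Fin 2 → ℂ} (hfree : I.free σ c = {q}) {b : Fin 2}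
    (hq : φ q = ket b) (hφ : ∀ p ∈ σ.A, φ p = σ.φ p) :
    (I.clause c).pairing φ = I.form σ c q b := by
  refine (I.clause c).pairing_congr fun p hp => ?_
  by_cases hpq : p = q
  · subst hpq; rw [Function.update_self, hq]
  · rw [Function.update_of_ne hpq]
    exact hφ p ((Instance.mem_supp_of_free hfree).2.2 p hp hpq)

theorem output_congr {s u : Memory} (h : u.cpx 1 = s.cpx 1) :
    (u.output : Fin n → Fin 2 → ℂ) = s.output := by
  funext q b; simp only [Memory.output, h]

theorem wp_unitStep (hN : I.size ≤ N) (hs : Represents I σ s) (hc : s.nat 13 0 = c)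
    (hfree : I.free σ c = {q}) (hq : s.nat 17 0 = q) :
    Wp N .unitStep s (Represents I (I.unitStep σ c q)) := by
  have hqA := (Instance.mem_supp_of_free hfree).2.1
  have hne : ∀ p ∈ σ.A, p ≠ q := by rintro p hp rfl; exact hqA hp
  have hket0 : (![1, 0] : Fin 2 → ℂ) = ket 0 := by
    funext b; fin_cases b <;> simp [ket]
  have hket1 : (![0, 1] : Fin 2 → ℂ) = ket 1 := by
    funext b; fin_cases b <;> simp [ket]
  refine Wp.seq (Wp.setNat ?_)
  set s₀ := s.writeNat 8 ((NExp.var 13).eval s) ((NExp.lit 1).eval s) with hs₀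
  have l₀ : Loaded I s₀ := hs.loaded.congr (by simp [hs₀]) (by simp [hs₀])
  have c₀ : s₀.nat 13 0 = c := by simp [hs₀, hc]
  have q₀ : s₀.nat 17 0 = q := by simp [hs₀, hq]
  have o₀ : ∀ p ∈ σ.A, s₀.output p = σ.φ p := fun p hp => hs.φ p hp
  refine Wp.seq ((wp_setVec (e := .var 17) (q := q) q₀ rfl).mono fun s₁ F₁ h₁ => ?_)
  have l₁ := l₀.frame F₁ (by decide) rfl
  have c₁ : s₁.nat 13 0 = c := by rw [F₁.nat 13 rfl, c₀]
  refine Wp.seq ((wp_contract hN l₁ c₁).mono fun s₂ F₂ h₂ => Wp.seq (Wp.setCpx ?_))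
  rw [pairing_eq_form hfree (b := 0) (by simp [h₁, hket0])
    (fun p hp => by rw [h₁, Function.update_of_ne (hne p hp), o₀ p hp])] at h₂
  set s₂' := s₂.writeCpx 4 _ _ with hs₂
  have l₂ : Loaded I s₂' := (l₁.frame F₂ (by decide) rfl).congr (by simp [hs₂]) (by simp [hs₂])
  have c₂ : s₂'.nat 13 0 = c := by simp [hs₂, F₂.nat 13 rfl, c₁]
  have q₂ : s₂'.nat 17 0 = q := by simp [hs₂, F₂.nat 17 rfl, F₁.nat 17 rfl, q₀]
  have o₂ : (s₂'.output : Fin n → Fin 2 → ℂ) = s₁.output :=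
    output_congr (by simp [hs₂, F₂.cpx 1 rfl])
  have u₂ : s₂'.cpx 4 0 = I.form σ c q 0 := by simp [hs₂, h₂]
  refine Wp.seq ((wp_setVec (e := .var 17) (q := q) q₂ rfl).mono fun s₃ F₃ h₃ => ?_)
  have l₃ := l₂.frame F₃ (by decide) rfl
  have c₃ : s₃.nat 13 0 = c := by rw [F₃.nat 13 rfl, c₂]
  refine Wp.seq ((wp_contract hN l₃ c₃).mono fun s₄ F₄ h₄ => Wp.seq (Wp.setCpx ?_))
  rw [pairing_eq_form hfree (b := 1) (by simp [h₃, hket1]) (fun p hp => by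
    rw [h₃, Function.update_of_ne (hne p hp), o₂, h₁, Function.update_of_ne (hne p hp),
      o₀ p hp])] at h₄
  set s₄' := s₄.writeCpx 4 _ _ with hs₄
  have l₄ : Loaded I s₄' := (l₃.frame F₄ (by decide) rfl).congr (by simp [hs₄]) (by simp [hs₄])
  have q₄ : s₄'.nat 17 0 = q := by simp [hs₄, F₄.nat 17 rfl, F₃.nat 17 rfl, q₂]
  have o₄ : (s₄'.output : Fin n → Fin 2 → ℂ) = s₃.output :=
    output_congr (by simp [hs₄, F₄.cpx 1 rfl])
  have u₄ : s₄'.cpx 4 0 = I.form σ c q 0 := by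
    simp [hs₄, F₄.cpx 4 rfl, F₃.cpx 4 rfl, u₂]
  have u₄' : s₄'.cpx 4 1 = I.form σ c q 1 := by simp [hs₄, h₄]
  refine Wp.seq ((wp_setVec (e := .var 17) (q := q) q₄ (by simp)).mono fun s₅ F₅ h₅ => ?_)
  have l₅ := l₄.frame F₅ (by decide) rfl
  have q₅ : s₅.nat 17 0 = q := by rw [F₅.nat 17 rfl, q₄]
  have n₅ : ∀ a ∈ [7, 8], s₅.nat a = s₀.nat a := by
    simp only [List.forall_mem_cons]
    refine ⟨?_, ?_, by simp⟩
    · rw [F₅.nat 7 rfl]; simp [hs₄, F₄.nat 7 rfl, F₃.nat 7 rfl, hs₂, F₂.nat 7 rfl, F₁.nat 7 rfl]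
    · rw [F₅.nat 8 rfl]; simp [hs₄, F₄.nat 8 rfl, F₃.nat 8 rfl, hs₂, F₂.nat 8 rfl, F₁.nat 8 rfl]
  have r₅ : s₅.cpx 3 0 = σ.r := by
    rw [F₅.cpx 3 rfl]
    simp [hs₄, F₄.cpx 3 rfl, F₃.cpx 3 rfl, hs₂, F₂.cpx 3 rfl, F₁.cpx 3 rfl, hs₀, hs.r]
  have o₅ : ∀ p, p = q ∨ p ∈ σ.A → s₅.output p = (I.unitStep σ c q).φ p := by
    intro p hp
    change _ = Function.update σ.φ q ![-I.form σ c q 1, I.form σ c q 0] p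
    by_cases hpq : p = q
    · subst hpq
      rw [h₅, Function.update_self, Function.update_self]
      simp [u₄, u₄']
    · have hpA := hp.resolve_left hpq
      rw [h₅, Function.update_of_ne hpq, Function.update_of_ne hpq, o₄, h₃,
        Function.update_of_ne hpq, o₂, h₁, Function.update_of_ne hpq, o₀ p hpA]
  have d₅ : ∀ j : Fin I.m, s₅.nat 8 j = 0 ↔ j ∉ insert c σ.D := by
    intro j
    rw [n₅ 8 (by simp), Finset.mem_insert]
    by_cases hj : j = c
    · simp [hs₀, hc, hj]
    · have : (j : ℕ) ≠ c := fun h => hj (Fin.ext h)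
      simp [hs₀, hc, hj, this, hs.D]
  have a₅ : ∀ p : Fin n, s₅.nat 7 p = 0 ↔ p ∉ σ.A := by
    intro p
    rw [n₅ 7 (by simp)]
    simpa [hs₀] using hs.A p
  have u₅ : s₅.cpx 4 0 = I.form σ c q 0 := by rw [F₅.cpx 4 rfl, u₄]
  have u₅' : s₅.cpx 4 1 = I.form σ c q 1 := by rw [F₅.cpx 4 rfl, u₄']
  refine Wp.ite (fun hb => Wp.skip ?_) fun hb => Wp.setNat ?_
  · simp only [Test.Holds, CExp.eval, NExp.eval, u₅, u₅'] at hb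
    have hA : (I.unitStep σ c q).A = σ.A := if_pos hb
    exact ⟨l₅, by rwa [hA], d₅, fun p hp => o₅ p (Or.inr (hA ▸ hp)), r₅⟩
  · simp only [Test.Holds, CExp.eval, NExp.eval, u₅, u₅'] at hb
    have hA : (I.unitStep σ c q).A = insert q σ.A := if_neg hb
    refine ⟨l₅.congr (by simp) rfl, fun p => ?_, fun j => ?_, fun p hp => ?_, r₅⟩
    · rw [hA, Finset.mem_insert]
      by_cases hpq : p = q
      · simp [hpq, q₅]
      · have : (p : ℕ) ≠ q := fun h => hpq (Fin.ext h)
        simp [hpq, q₅, this, a₅]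
    · rw [Memory.writeNat_nat_of_ne _ _ _ (by decide)]
      exact d₅ j
    · rw [hA, Finset.mem_insert] at hp
      exact o₅ p hp

theorem wp_step (hN : I.size ≤ N) (hs : Represents I σ s) (hc : s.nat 13 0 = c) :
    Wp N .step s (Represents I (I.step σ c)) := by
  refine Wp.ite (fun hb => ?_) fun hb => Wp.skip ?_
  swap
  · have : σ.r ≠ 0 ∨ c ∈ σ.D := by
      simp only [Test.Holds, CExp.eval, NExp.eval, hc, hs.r, Nat.le_zero, hs.D] at hb
      tauto
    rwa [Instance.step_of_skip this]
  simp only [Test.Holds, CExp.eval, NExp.eval, hc, hs.r, Nat.le_zero, hs.D] at hb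
  obtain ⟨hr, hcD⟩ := hb
  refine Wp.seq ((wp_countFree hN hs.loaded hc hs.A).mono fun u F h => ?_)
  have hu : Represents I σ u := by
    refine hs.congr (fun a ha => F.nat a ?_) fun a ha => F.cpx a rfl
    revert a; decide
  have cu : u.nat 13 0 = c := by rw [F.nat 13 rfl, hc]
  refine Wp.ite (fun hb => ?_) fun hb => Wp.ite (fun hb' => ?_) fun hb' => Wp.skip ?_
  · simp only [Test.Holds, NExp.eval, h.1, Nat.le_zero, Finset.card_eq_zero] at hb
    refine Wp.seq ((wp_contract hN hu.loaded cu).mono fun w F' h' => Wp.seq (Wp.setCpx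
      (Wp.setNat ?_)))
    have hw : w.nat 13 0 = c := by rw [F'.nat 13 rfl, cu]
    rw [Instance.step_of_free_empty hr hcD hb]
    refine ⟨(hu.loaded.frame F' (by decide) rfl).congr (by simp) (by simp), ?_, ?_, ?_, ?_⟩
    · simpa [F'.nat 7 rfl] using hu.A
    · intro j
      by_cases hj : j = c
      · simp [hj, hw]
      · have : (j : ℕ) ≠ c := fun h => hj (Fin.ext h)
        simp [hj, hw, this, F'.nat 8 rfl, hu.D]
    · intro p hp
      rw [← hu.φ p hp]
      exact congrFun (output_congr (by simp [F'.cpx 1 rfl])) p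
    · simp only [Memory.writeNat_cpx, Memory.writeCpx_cpx, NExp.eval, CExp.eval, h']
      simp only [and_self, if_true]
      refine (I.clause c).pairing_congr fun p hp => hu.φ p ?_
      by_contra hpA
      have : p ∈ I.free σ c := Finset.mem_sdiff.2 ⟨hp, hpA⟩
      simp [hb] at this
  · simp only [Test.Holds, NExp.eval, h.1] at hb hb'
    obtain ⟨q, hq⟩ := Finset.card_eq_one.1 (show (I.free σ c).card = 1 by omega)
    obtain ⟨q', hq', hq17⟩ := h.2 (by simp [hq])
    rw [hq, Finset.mem_singleton] at hq'
    subst hq'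
    rw [Instance.step_of_free_singleton hr hcD hq]
    exact wp_unitStep hN hu cu hq hq17
  · simp only [Test.Holds, NExp.eval, h.1] at hb'
    rwa [Instance.step_of_two_le (by omega)]

theorem wp_propagate (hN : I.size ≤ N) (hs : Represents I σ s) :
    Wp N .propagate s (Represents I (I.propagate σ)) := by
  have hm : I.m ≤ N := (Nat.le_add_left _ _).trans (I.n_add_m_le_size.trans hN)
  refine Wp.forTo (n := I.m) (fun j u => Represents I (I.sweep^[j] σ) u) rfl hm ?_ ?_ hs ?_ ?_
  · intro u F
    simp [F.nat 0 rfl, hs.loaded.m]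
  · intro j u v h
    exact h.congr (by simp) (by simp)
  · intro j u _ _ _ hu
    refine Wp.forTo (n := I.m)
      (fun i w => Represents I (((List.finRange I.m).take i).foldl I.step (I.sweep^[j] σ)) w)
      rfl hm ?_ ?_ hu ?_ ?_
    · intro w F
      simp [F.nat 0 rfl, hu.loaded.m]
    · intro i w v h
      exact h.congr (by simp) (by simp)
    · intro i w hi _ hk hw
      have := wp_step (c := ⟨i, hi⟩) hN hw hk
      rw [List.take_add_one, List.foldl_append]
      simpa [hi] using this
    · intro w _ hw
      rw [Function.iterate_succ_apply', Instance.sweep]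
      rwa [List.take_of_length_le (by simp)] at hw
  · exact fun u _ hu => hu

end

/-! ### Choosing a vector for a free qubit -/

/-- A root of a quadratic form, in terms of its values at `(1, 0)`, `(0, 1)` and `(1, 1)`. -/
theorem IsQuad.root {Q : (Fin 2 → ℂ) → ℂ} (hQ : IsQuad Q) :
    let b := Q ![1, 1] - Q ![1, 0] - Q ![0, 1]
    Q ![0 - b + Complex.sqrt (b * b - (Q ![1, 0] + Q ![1, 0]) * (Q ![0, 1] + Q ![0, 1])),
      Q ![1, 0] + Q ![1, 0]] = 0 := by
  intro b
  obtain ⟨x, y, z, h⟩ := hQ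
  have hb : b = y := by simp [b, h]; ring
  have h10 : Q ![1, 0] = x := by simp [h]
  have h01 : Q ![0, 1] = z := by simp [h]
  rw [hb, h10, h01, h]
  have hs : Complex.sqrt (y * y - (x + x) * (z + z)) ^ 2 = y * y - (x + x) * (z + z) := by
    have := Complex.cpow_nat_inv_pow (y * y - (x + x) * (z + z)) (n := 2) (by norm_num)
    simpa only [Complex.sqrt, Nat.cast_ofNat] using this
  simp only [Matrix.cons_val_zero, Matrix.cons_val_one]
  linear_combination x * hs

namespace Instance

variable {k n : ℕ} {I : Instance k n} {σ : State n I.m} {q : Fin n}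

theorem propagate_extends (σ : State n I.m) :
    σ.A ⊆ (I.propagate σ).A ∧ ∀ p ∈ σ.A, (I.propagate σ).φ p = σ.φ p := by
  refine propagate_induction (p := fun τ => σ.A ⊆ τ.A ∧ ∀ p ∈ σ.A, τ.φ p = σ.φ p) ?_
    ⟨subset_rfl, fun _ _ => rfl⟩
  intro τ c h
  refine ⟨h.1.trans subset_step_A, fun p hp => ?_⟩
  rcases step_cases τ c with ⟨_, h'⟩ | ⟨_, _, _, h'⟩ | ⟨_, _, q, hf, h'⟩ <;> rw [h']
  · exact h.2 p hp
  · exact h.2 p hp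
  · rw [unitStep]
    dsimp only
    rw [Function.update_of_ne, h.2 p hp]
    rintro rfl
    exact (mem_supp_of_free hf).2.1 (h.1 hp)

variable (I) in
/-- A sound and stable state without violation, from which the next free qubit can be chosen. -/
structure Good (σ : State n I.m) : Prop where
  sound : I.Sound σ
  stable : I.Stable σ
  r : σ.r = 0

theorem Good.propagate_assign (h : I.Good σ) (hq : q ∉ σ.A) {v : Fin 2 → ℂ} (hv : v ≠ 0)
    (hr : (I.propagate (σ.assign q v)).r = 0) : I.Good (I.propagate (σ.assign q v)) := by
  refine ⟨propagate_induction (fun _ _ h => h.step) ⟨?_, ?_⟩, stable_propagate _, hr⟩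
  · intro p hp
    simp only [State.assign] at hp ⊢
    by_cases hpq : p = q
    · subst hpq; rwa [Function.update_self]
    · rw [Function.update_of_ne hpq]
      exact h.sound.1 p ((Finset.mem_insert.1 hp).resolve_left hpq)
  · intro hr' c hc φ' hφ'
    refine h.sound.2 hr' c hc φ' fun p hp => ?_
    rw [hφ' p (Finset.mem_insert_of_mem hp)]
    simp only [State.assign]
    rw [Function.update_of_ne]
    rintro rfl; exact hq hp

end Instance

namespace Program

/-- Copy the flags of qubits and clauses from the arrays `a` and `b` to `a'` and `b'`. -/
def copyFlags (a b a' b' : ℕ) : Program :=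
  .forTo 11 (.var 18) (.seq (.setNat a' (.var 11) (.get a (.var 11)))
    (.setNat b' (.var 11) (.get b (.var 11))))

/-- Return to the saved flags, give the vector `(x, y)` to the current qubit and propagate. -/
def trial (x y : CExp) : Program :=
  .seq (copyFlags 9 10 7 8)
  (.seq (setVec (.var 15) x y)
  (.seq (.setCpx 3 (.lit 0) .zero)
  (.seq (.setNat 7 (.var 15) (.lit 1)) propagate)))

/-- The middle coefficient of a quadratic form whose values at `(1, 0)`, `(0, 1)` and `(1, 1)` are
in complex array `6`. -/
abbrev midCoeff : CExp :=
  .sub (.sub (.get 6 (.lit 2)) (.get 6 (.lit 0))) (.get 6 (.lit 1))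

/-- Find a vector for the current qubit, if it is free: try `(1, 0)`, `(0, 1)` and `(1, 1)`, and
then a root of the quadratic form that describes the residuals. -/
def choose : Program :=
  .ite (.le (.get 7 (.var 15)) (.lit 0))
    (.seq (copyFlags 7 8 9 10)
    (.seq (trial .one .zero) (.ite (.isZero (.get 3 (.lit 0))) .skip
    (.seq (.setCpx 6 (.lit 0) (.get 3 (.lit 0)))
    (.seq (trial .zero .one) (.ite (.isZero (.get 3 (.lit 0))) .skip
    (.seq (.setCpx 6 (.lit 1) (.get 3 (.lit 0)))
    (.seq (trial .one .one) (.ite (.isZero (.get 3 (.lit 0))) .skip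
    (.seq (.setCpx 6 (.lit 2) (.get 3 (.lit 0)))
      (trial
        (.add (.sub .zero midCoeff) (.sqrt (.sub (.mul midCoeff midCoeff)
          (.mul (.add (.get 6 (.lit 0)) (.get 6 (.lit 0)))
            (.add (.get 6 (.lit 1)) (.get 6 (.lit 1)))))))
        (.add (.get 6 (.lit 0)) (.get 6 (.lit 0))))))))))))))
    .skip

end Program

/-- The flags of the state `σ` are saved, and the vectors of its assigned qubits are in place. -/
structure Saved {k n : ℕ} (I : Instance k n) (σ : State n I.m) (s : Memory) : Prop where
  loaded : Loaded I s
  A : ∀ q : Fin n, s.nat 9 q = 0 ↔ q ∉ σ.A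
  D : ∀ c : Fin I.m, s.nat 10 c = 0 ↔ c ∉ σ.D
  φ : ∀ q ∈ σ.A, s.output q = σ.φ q
  len : s.nat 18 0 = n + I.m

section

variable {k n N : ℕ} {I : Instance k n} {σ : State n I.m} {s : Memory} {q : Fin n}

theorem wp_copyFlags {a b a' b' len : ℕ} (h : [a, b, a', b', 11, 18].Nodup) (hlen : len ≤ N)
    (hs : s.nat 18 0 = len) :
    Wp N (.copyFlags a b a' b') s fun u =>
      ∀ i < len, u.nat a' i = s.nat a i ∧ u.nat b' i = s.nat b i := by
  simp only [List.nodup_cons, List.mem_cons, List.not_mem_nil, not_or, or_false] at h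
  obtain ⟨⟨h1, h2, h3, h4, h5⟩, ⟨h6, h7, h8, h9⟩, ⟨h10, h11, h12⟩, ⟨h13, h14⟩, h15, -⟩ := h
  refine Wp.forTo (n := len) (fun j u => ∀ i < j, u.nat a' i = s.nat a i ∧ u.nat b' i = s.nat b i)
    ?_ hlen ?_ ?_ ?_ ?_ fun u _ hu => hu
  · simp [Program.writesNat, Ne.symm h11, Ne.symm h13]
  · intro u F
    have : u.nat 18 = s.nat 18 := F.nat 18
      (by simp [Program.forTo, Program.writesNat, Ne.symm h12, Ne.symm h14])
    simp [this, hs]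
  · intro j u v hu
    simpa [h11, h13] using hu
  · intro i hi; omega
  · intro j u hj F hk hu
    have ea : u.nat a = s.nat a := F.nat a (by simp [Program.forTo, Program.writesNat, h2, h3, h4])
    have eb : u.nat b = s.nat b := F.nat b (by simp [Program.forTo, Program.writesNat, h6, h7, h8])
    refine Wp.seq (Wp.setNat (Wp.setNat fun i hi => ?_))
    by_cases hij : i = j
    · simp [hij, hk, ea, eb, h6, h10, Ne.symm h11]
    · simp [hij, hk, Ne.symm h11, hu i (by omega)]

theorem wp_trial (hN : I.size ≤ N) (hs : Saved I σ s) (hr : σ.r = 0)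
    (h15 : s.nat 15 0 = q) {x y : CExp} {v : Fin 2 → ℂ} (hq : q ∉ σ.A)
    (hx : ∀ u, u.cpx 6 = s.cpx 6 → x.eval u = v 0)
    (hy : ∀ u, u.cpx 6 = s.cpx 6 → y.eval u = v 1) :
    Wp N (.trial x y) s fun u =>
      Represents I (I.propagate (σ.assign q v)) u ∧ Saved I σ u := by
  have hlen := I.n_add_m_le_size.trans hN
  refine Wp.mono (R := fun u => _ ∧ _) (Q := Represents I (I.propagate (σ.assign q v))) ?_ ?_
  · refine Wp.seq ((wp_copyFlags (by decide) hlen hs.len).mono fun s₁ F₁ h₁ => ?_)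
    have e₁ : s₁.nat 15 0 = q := by rw [F₁.nat 15 rfl, h15]
    have x₁ := hx s₁ (F₁.cpx 6 rfl)
    have y₁ := hy s₁ (F₁.cpx 6 rfl)
    refine Wp.seq ((wp_setVec (e := .var 15) (q := q) e₁ ?_).mono fun s₂ F₂ h₂ => ?_)
    · rw [y₁, hy]
      simp [F₁.cpx 6 rfl]
    rw [x₁, y₁] at h₂
    have e₂ : s₂.nat 15 0 = q := by rw [F₂.nat 15 rfl, e₁]
    refine Wp.seq (Wp.setCpx (Wp.seq (Wp.setNat (wp_propagate hN ⟨?_, ?_, ?_, ?_, ?_⟩))))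
    · exact ((hs.loaded.frame F₁ (by decide) rfl).frame F₂
        (by simp [Program.setVec, Program.writesNat]) rfl).congr (by simp) (by simp)
    · intro p
      by_cases hpq : p = q
      · simp [hpq, e₂, State.assign]
      · have hne : (p : ℕ) ≠ q := fun h => hpq (Fin.ext h)
        have := (h₁ p (by omega)).1
        simp [hpq, e₂, hne, State.assign, F₂.nat 7 rfl, this, hs.A]
    · intro c
      have := (h₁ c (by omega)).2
      simp [State.assign, F₂.nat 8 rfl, this, hs.D]
    · intro p hp
      refine (congrFun (output_congr (s := s₂) (by simp)) p).trans ?_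
      rw [h₂]
      by_cases hpq : p = q
      · subst hpq
        simp only [State.assign, Function.update_self]
        funext b; fin_cases b <;> rfl
      · have hpA : p ∈ σ.A := (Finset.mem_insert.1 hp).resolve_left hpq
        simp only [State.assign, Function.update_of_ne hpq]
        rw [output_congr (F₁.cpx 1 rfl), hs.φ p hpA]
    · simp [State.assign, hr]
  · intro u F hu
    refine ⟨hu, hs.loaded.frame F ?_ rfl, ?_, ?_, ?_, ?_⟩
    · simp [Program.trial, Program.copyFlags, Program.setVec, Program.forTo, Program.writesNat,
        show ∀ a ∈ [0, 1, 2, 4, 5, 6], Program.propagate.writesNat a = false by decide]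
    · rw [F.nat 9 rfl]; exact hs.A
    · rw [F.nat 10 rfl]; exact hs.D
    · intro p hp
      have hext := Instance.propagate_extends (I := I) (σ.assign q v)
      have hp' : p ∈ (σ.assign q v).A := Finset.mem_insert_of_mem hp
      rw [hu.φ p (hext.1 hp'), hext.2 p hp']
      simp only [State.assign]
      rw [Function.update_of_ne]
      rintro rfl; exact hq hp
    · rw [F.nat 18 rfl]; exact hs.len

theorem wp_choose (hN : I.size ≤ N) (hocc : ∀ q, I.occurrences q ≤ 2) (hs : Represents I σ s)
    (hσ : I.Good σ) (hlen : s.nat 18 0 = n + I.m) (h15 : s.nat 15 0 = q) :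
    Wp N .choose s fun u => ∃ τ, Represents I τ u ∧ I.Good τ ∧ insert q σ.A ⊆ τ.A := by
  refine Wp.ite (fun hb => ?_) fun hb => Wp.skip ⟨σ, hs, hσ, ?_⟩
  swap
  · simp only [Test.Holds, NExp.eval, h15, Nat.le_zero, hs.A, not_not] at hb
    exact Finset.insert_subset hb subset_rfl
  simp only [Test.Holds, NExp.eval, h15, Nat.le_zero, hs.A] at hb
  obtain ⟨Q, hQ, hQr⟩ := Instance.exists_isQuad hocc hσ.stable hσ.r hb
  have hdone : ∀ (v : Fin 2 → ℂ) (u : Memory), v ≠ 0 →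
      Represents I (I.propagate (σ.assign q v)) u → u.cpx 3 0 = 0 →
      ∃ τ, Represents I τ u ∧ I.Good τ ∧ insert q σ.A ⊆ τ.A := fun v u hv hu h0 =>
    ⟨_, hu, hσ.propagate_assign hb hv (hu.r ▸ h0), (Instance.propagate_extends (σ.assign q v)).1⟩
  have hval : ∀ (v : Fin 2 → ℂ) (u : Memory), Represents I (I.propagate (σ.assign q v)) u →
      u.cpx 3 0 ≠ 0 → u.cpx 3 0 = Q v := fun v u hu h0 =>
    hu.r.trans ((hQr v).resolve_left (hu.r ▸ h0))
  have hset : ∀ (i : NExp) (e : CExp) (u : Memory), Saved I σ u →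
      Saved I σ (u.writeCpx 6 (i.eval u) (e.eval u)) := fun i e u hu =>
    ⟨hu.loaded.congr (by simp) (by simp), hu.A, hu.D, hu.φ, hu.len⟩
  refine Wp.seq ((wp_copyFlags (by decide) (I.n_add_m_le_size.trans hN) hlen).mono
    fun s₀ F₀ h₀ => ?_)
  have S₀ : Saved I σ s₀ := by
    refine ⟨hs.loaded.frame F₀ (by decide) rfl, fun p => ?_, fun c => ?_, fun p hp => ?_, ?_⟩
    · rw [(h₀ p (by omega)).1, hs.A]
    · rw [(h₀ c (by omega)).2, hs.D]
    · rw [output_congr (F₀.cpx 1 rfl), hs.φ p hp]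
    · rw [F₀.nat 18 rfl, hlen]
  have e₀ : s₀.nat 15 0 = q := by rw [F₀.nat 15 rfl, h15]
  refine Wp.seq ((wp_trial hN S₀ hσ.r e₀ (v := ![1, 0]) hb (fun _ _ => rfl) fun _ _ => rfl).mono
    fun s₁ F₁ h₁ => Wp.ite (fun hz => Wp.skip (hdone _ _ (by simp) h₁.1 hz)) fun hz => ?_)
  have e₁ : s₁.nat 15 0 = q := by rw [F₁.nat 15 rfl, e₀]
  refine Wp.seq (Wp.setCpx (Wp.seq ((wp_trial hN (hset _ _ _ h₁.2) hσ.r e₁ (v := ![0, 1]) hb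
    (fun _ _ => rfl) fun _ _ => rfl).mono
    fun s₂ F₂ h₂ => Wp.ite (fun hz' => Wp.skip (hdone _ _ (by simp) h₂.1 hz')) fun hz' => ?_)))
  have e₂ : s₂.nat 15 0 = q := by rw [F₂.nat 15 rfl]; exact e₁
  refine Wp.seq (Wp.setCpx (Wp.seq ((wp_trial hN (hset _ _ _ h₂.2) hσ.r e₂ (v := ![1, 1]) hb
    (fun _ _ => rfl) fun _ _ => rfl).mono
    fun s₃ F₃ h₃ => Wp.ite (fun hz'' => Wp.skip (hdone _ _ (by simp) h₃.1 hz'')) fun hz'' => ?_)))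
  have e₃ : s₃.nat 15 0 = q := by rw [F₃.nat 15 rfl]; exact e₂
  have r₁ := hval _ _ h₁.1 hz
  have r₂ := hval _ _ h₂.1 hz'
  have r₃ := hval _ _ h₃.1 hz''
  refine Wp.seq (Wp.setCpx ?_)
  set s₄ := s₃.writeCpx 6 _ _ with hs₄
  have v0 : s₄.cpx 6 0 = Q ![1, 0] := by
    simp [hs₄, F₃.cpx 6 rfl, F₂.cpx 6 rfl, r₁]
  have v1 : s₄.cpx 6 1 = Q ![0, 1] := by
    simp [hs₄, F₃.cpx 6 rfl, r₂]
  have v2 : s₄.cpx 6 2 = Q ![1, 1] := by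
    simp [hs₄, r₃]
  have hne : Q ![1, 0] ≠ 0 := r₁ ▸ hz
  set b := Q ![1, 1] - Q ![1, 0] - Q ![0, 1] with hb'
  set v : Fin 2 → ℂ :=
    ![0 - b + Complex.sqrt (b * b - (Q ![1, 0] + Q ![1, 0]) * (Q ![0, 1] + Q ![0, 1])),
      Q ![1, 0] + Q ![1, 0]] with hv
  have hroot : Q v = 0 := hQ.root
  refine (wp_trial hN (hset _ _ _ h₃.2) hσ.r (v := v) (q := q) e₃ hb ?_ ?_).mono
    fun u _ hu => hdone v u ?_ hu.1 ?_
  · intro u hu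
    change u.cpx 6 = s₄.cpx 6 at hu
    simp only [CExp.eval, NExp.eval, hu, v0, v1, v2]
    rfl
  · intro u hu
    change u.cpx 6 = s₄.cpx 6 at hu
    simp only [CExp.eval, NExp.eval, hu, v0]
    rfl
  · intro h
    have := congrFun h 1
    simp only [hv, Matrix.cons_val_one, Pi.zero_apply, ← two_mul] at this
    simp [hne] at this
  · rw [hu.1.r]
    exact (hQr v).elim id fun h => h.trans hroot

end

/-! ### Reading the input -/

/-- The position in `L.flatten` at which the member `j` of `L` starts. -/
def startPos {α : Type} (L : List (List α)) (j : ℕ) : ℕ := ((L.take j).map List.length).sum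

theorem startPos_succ {α : Type} (L : List (List α)) {j : ℕ} (hj : j < L.length) :
    startPos L (j + 1) = startPos L j + L[j].length := by
  rw [startPos, startPos, List.take_add_one, List.getElem?_eq_getElem hj]
  simp only [Option.toList_some, List.map_append, List.map_cons, List.map_nil, List.sum_append,
    List.sum_cons, List.sum_nil, add_zero]

theorem getD_flatten {α : Type} (d : α) (L : List (List α)) {j : ℕ} (hj : j < L.length) {i : ℕ}
    (hi : i < L[j].length) : L.flatten.getD (startPos L j + i) d = L[j].getD i d := by
  induction L generalizing j with
  | nil => simp at hj
  | cons l L ih =>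
    cases j with
    | zero =>
      simp only [List.getElem_cons_zero] at hi
      have hs : startPos (l :: L) 0 = 0 := by simp [startPos]
      rw [hs, zero_add, List.flatten_cons, List.getD_append _ _ _ _ hi]
      simp
    | succ j =>
      simp only [List.getElem_cons_succ] at hi
      have hs : startPos (l :: L) (j + 1) + i = l.length + (startPos L j + i) := by
        simp [startPos, add_assoc]
      rw [hs, List.flatten_cons, List.getD_append_right _ _ _ _ (Nat.le_add_right _ _),
        Nat.add_sub_cancel_left, ih (by simpa using hj) hi]
      simp

namespace Program

/-- Compute the table of positions of the clauses. -/
def prepare : Program :=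
  .seq (.setNat 18 (.lit 0) (.add (.get 0 (.lit 0)) (.get 0 (.lit 1))))
  (.forTo 13 (.get 0 (.lit 1))
    (.seq (.setNat 4 (.var 13) (.var 19))
    (.seq (.setNat 5 (.var 13) (.var 20))
    (.seq (.setNat 6 (.var 13) (.lit 1))
    (.seq (.forTo 11 (.get 1 (.var 13))
      (.setNat 6 (.var 13) (.add (.get 6 (.var 13)) (.get 6 (.var 13)))))
    (.seq (.setNat 19 (.lit 0) (.add (.var 19) (.get 1 (.var 13))))
      (.setNat 20 (.lit 0) (.add (.var 20) (.get 6 (.var 13))))))))))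

/-- Normalise the vectors of all qubits. -/
def normalise : Program :=
  .forTo 15 (.get 0 (.lit 0))
    (.seq (.setCpx 4 (.lit 0) (.sqrt (.add
      (.mul (.get 1 (.add (.var 15) (.var 15)))
        (.conj (.get 1 (.add (.var 15) (.var 15)))))
      (.mul (.get 1 (.add (.add (.var 15) (.var 15)) (.lit 1)))
        (.conj (.get 1 (.add (.add (.var 15) (.var 15)) (.lit 1))))))))
    (setVec (.var 15) (.div (.get 1 (.add (.var 15) (.var 15))) (.get 4 (.lit 0)))
      (.div (.get 1 (.add (.add (.var 15) (.var 15)) (.lit 1))) (.get 4 (.lit 0)))))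

/-- The decision algorithm. -/
def solve : Program :=
  .seq prepare (.seq propagate
    (.ite (.isZero (.get 3 (.lit 0)))
      (.seq (.forTo 15 (.get 0 (.lit 0)) choose)
        (.seq normalise (.setNat 3 (.lit 0) (.lit 1))))
      .skip))

end Program

/-- The norm of a vector of `ℂ²`, as computed by the algorithm. -/
def vecNorm (v : Fin 2 → ℂ) : ℂ := Complex.sqrt (v 0 * star (v 0) + v 1 * star (v 1))

theorem isState_div_vecNorm {v : Fin 2 → ℂ} (hv : v ≠ 0) : IsState fun b => v b / vecNorm v := by
  set t : ℝ := ‖v 0‖ ^ 2 + ‖v 1‖ ^ 2 with ht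
  have hsq : vecNorm v ^ 2 = (t : ℂ) := by
    have := Complex.cpow_nat_inv_pow (v 0 * star (v 0) + v 1 * star (v 1)) (n := 2) (by norm_num)
    rw [vecNorm, Complex.sqrt]
    rw [Nat.cast_ofNat] at this
    rw [this, ht]
    simp only [Complex.star_def, Complex.mul_conj, Complex.normSq_eq_norm_sq]
    push_cast; rfl
  have hn : ‖vecNorm v‖ ^ 2 = t := by
    rw [← norm_pow, hsq, Complex.norm_real, Real.norm_of_nonneg (by positivity)]
  have htne : t ≠ 0 := by
    intro h0
    apply hv
    have h1 : ‖v 0‖ ^ 2 = 0 := by nlinarith [sq_nonneg ‖v 0‖, sq_nonneg ‖v 1‖]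
    have h2 : ‖v 1‖ ^ 2 = 0 := by nlinarith [sq_nonneg ‖v 0‖, sq_nonneg ‖v 1‖]
    funext b
    fin_cases b
    · simpa using h1
    · simpa using h2
  simp only [IsState, norm_div, div_pow, hn, Fin.sum_univ_two]
  rw [← add_div, ← ht, div_self htne]

section

variable {k n N : ℕ} {I : Instance k n} {s : Memory}

variable (I) in
/-- The state in which no qubit is assigned. -/
def Instance.start : State n I.m := ⟨∅, ∅, fun _ => 0, 0⟩

theorem wp_prepare (hN : I.size ≤ N) : Wp N .prepare I.encode fun u =>
    Represents I I.start u ∧ u.nat 18 0 = n + I.m ∧ u.nat 3 0 = 0 := by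
  have hm : I.m ≤ N := (Nat.le_add_left _ _).trans (I.n_add_m_le_size.trans hN)
  set Lq : List (List ℕ) :=
    List.ofFn fun j => List.ofFn fun l => ((I.clause j).qubit l : ℕ) with hLq
  set La : List (List ℂ) := List.ofFn fun j => List.ofFn fun l : Fin (2 ^ (I.clause j).loc) =>
    (I.clause j).amp (finFunctionFinEquiv.symm l) with hLa
  have hlocN : ∀ c : Fin I.m, (I.clause c).loc ≤ N := fun c =>
    (Nat.le_add_right _ _).trans ((I.loc_add_pow_le_size c).trans hN)
  have e1 : ∀ c : Fin I.m, I.encode.nat 1 c = (I.clause c).loc := by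
    intro c; simp [Instance.encode]
  refine Wp.seq (Wp.setNat ?_)
  refine Wp.forTo (n := I.m) (fun j u => u.nat 19 0 = startPos Lq j ∧ u.nat 20 0 = startPos La j ∧
    ∀ c : Fin I.m, (c : ℕ) < j → u.nat 4 c = startPos Lq c ∧ u.nat 5 c = startPos La c ∧
      u.nat 6 c = 2 ^ (I.clause c).loc) rfl hm ?_ ?_ ?_ ?_ ?_
  · intro u F
    rw [NExp.eval, NExp.eval, F.nat 0 rfl]
    simp [Instance.encode]
  · intro j u v h
    simpa using h
  · simp [startPos, Instance.encode]
  · intro j u hj F hk ⟨h19, h20, h⟩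
    have e1u : u.nat 1 = I.encode.nat 1 := by rw [F.nat 1 rfl]; simp
    have e1j := e1 ⟨j, hj⟩
    simp only at e1j
    refine Wp.seq (Wp.setNat (Wp.seq (Wp.setNat (Wp.seq (Wp.setNat (Wp.seq ?_))))))
    refine Wp.forTo (n := (I.clause ⟨j, hj⟩).loc)
      (fun i w => w.nat 6 j = 2 ^ i ∧ ∀ l, l ≠ j → w.nat 6 l = u.nat 6 l) rfl (hlocN _) ?_ ?_ ?_ ?_ ?_
    · intro w F'
      rw [NExp.eval, NExp.eval, F'.nat 1 rfl, F'.nat 13 rfl]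
      simp [hk, e1u, e1j]
    · intro i w v hw
      simpa using hw
    · simp only [NExp.eval]
      refine ⟨by simp [hk], fun l hl => by simp [hk, hl]⟩
    · intro i w hi F' _ hw
      have h13 : w.nat 13 0 = j := by rw [F'.nat 13 rfl]; simp [hk]
      refine Wp.setNat ⟨?_, fun l hl => ?_⟩
      · simp [h13, hw.1, pow_succ, mul_two]
      · simp [h13, hl, hw.2 l hl]
    · intro w F' hw
      have h13 : w.nat 13 0 = j := by rw [F'.nat 13 rfl]; simp [hk]
      have h1 : w.nat 1 j = (I.clause ⟨j, hj⟩).loc := by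
        rw [F'.nat 1 rfl]; simp [e1u, e1j]
      have h19' : w.nat 19 0 = startPos Lq j := by rw [F'.nat 19 rfl]; simp [h19]
      have h20' : w.nat 20 0 = startPos La j := by rw [F'.nat 20 rfl]; simp [h20]
      have h4 : ∀ l, w.nat 4 l = if l = j then startPos Lq j else u.nat 4 l := by
        intro l; rw [F'.nat 4 rfl]; simp [hk, h19]
      have h5 : ∀ l, w.nat 5 l = if l = j then startPos La j else u.nat 5 l := by
        intro l; rw [F'.nat 5 rfl]; simp [hk, h20]
      refine Wp.seq (Wp.setNat (Wp.setNat ⟨?_, ?_, fun c hc => ?_⟩))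
      · rw [startPos_succ Lq (by simpa [hLq] using hj)]
        simp [h19', h13, h1, hLq]
      · rw [startPos_succ La (by simpa [hLa] using hj)]
        simp [h20', h13, hw.1, hLa]
      · by_cases hcj : (c : ℕ) = j
        · subst hcj
          simp [h4, h5, hw.1]
        · simpa [h4, h5, hcj, hw.2 c hcj] using h c (by omega)
  · intro u F ⟨_, _, h⟩
    have e0 : u.nat 0 = I.encode.nat 0 := by rw [F.nat 0 rfl]; simp
    have e1' : u.nat 1 = I.encode.nat 1 := by rw [F.nat 1 rfl]; simp
    have e2 : u.nat 2 = I.encode.nat 2 := by rw [F.nat 2 rfl]; simp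
    have e3 : u.nat 3 = I.encode.nat 3 := by rw [F.nat 3 rfl]; simp
    have e7 : u.nat 7 = I.encode.nat 7 := by rw [F.nat 7 rfl]; simp
    have e8 : u.nat 8 = I.encode.nat 8 := by rw [F.nat 8 rfl]; simp
    have c0 : u.cpx 0 = I.encode.cpx 0 := by rw [F.cpx 0 rfl]; rfl
    have c3 : u.cpx 3 = I.encode.cpx 3 := by rw [F.cpx 3 rfl]; rfl
    refine ⟨⟨⟨?_, ?_, ?_, ?_, ?_, ?_⟩, ?_, ?_, ?_, ?_⟩, ?_, ?_⟩
    · simp [e0, Instance.encode]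
    · simp [e0, Instance.encode]
    · intro c; rw [e1', e1]
    · intro c i
      rw [e2, (h c c.isLt).1]
      change Lq.flatten.getD _ _ = _
      rw [getD_flatten 0 Lq (by simp [hLq]) (by simp [hLq])]
      simp [hLq]
    · intro c l
      rw [c0, (h c c.isLt).2.1]
      change La.flatten.getD _ _ = _
      rw [getD_flatten 0 La (by simp [hLa]) (by simp [hLa])]
      simp [hLa]
    · exact fun c => (h c c.isLt).2.2
    · intro q; simp [e7, Instance.encode, Instance.start]
    · intro c; simp [e8, Instance.encode, Instance.start]
    · intro q hq; simp [Instance.start] at hq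
    · simp [c3, Instance.encode, Instance.start]
    · rw [F.nat 18 rfl]; simp [Instance.encode]
    · simp [e3, Instance.encode]

theorem wp_normalise (hN : n ≤ N) (hs : s.nat 0 0 = n) : Wp N .normalise s fun u =>
    ∀ q : Fin n, u.output q = fun b => s.output q b / vecNorm (s.output q) := by
  refine Wp.forTo (n := n) (fun j u => ∀ q : Fin n, u.output q =
    if (q : ℕ) < j then fun b => s.output q b / vecNorm (s.output q) else s.output q)
    rfl hN ?_ ?_ ?_ ?_ ?_
  · intro u F
    simp [F.nat 0 rfl, hs]
  · exact fun j u v h => h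
  · simp
  · intro j u hj F hk h
    have hq := h ⟨j, hj⟩
    simp only [lt_irrefl, if_false] at hq
    have q0 : u.cpx 1 (j + j) = s.output (⟨j, hj⟩ : Fin n) 0 := by
      rw [← hq]; simp [Memory.output, two_mul]
    have q1 : u.cpx 1 (j + j + 1) = s.output (⟨j, hj⟩ : Fin n) 1 := by
      rw [← hq]; simp [Memory.output, two_mul]
    refine Wp.seq (Wp.setCpx ?_)
    refine (wp_setVec (e := .var 15) (q := (⟨j, hj⟩ : Fin n)) (by simpa using hk) ?_).mono
      fun w _ hw p => ?_
    · simp [hk]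
    · rw [hw]
      by_cases hpj : p = ⟨j, hj⟩
      · subst hpj
        rw [Function.update_self]
        funext b
        fin_cases b
        · simp [hk, q0, q1, vecNorm]
        · simp [hk, q0, q1, vecNorm]
      · have : ¬ (p : ℕ) = j := fun h => hpj (Fin.ext h)
        rw [Function.update_of_ne hpj, output_congr (s := u) (by simp), h p]
        have : (p : ℕ) < j + 1 ↔ (p : ℕ) < j := by omega
        simp only [this]
  · intro u _ h q
    rw [h q, if_pos q.isLt]

/-- In a good state in which all qubits are assigned, the normalised vectors satisfy the instance. -/
theorem Instance.Good.satisfiedBy {σ : State n I.m} (h : I.Good σ) (hA : ∀ q, q ∈ σ.A) :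
    I.SatisfiedBy (productState fun q b => σ.φ q b / vecNorm (σ.φ q)) := by
  refine ⟨isState_productState fun q => isState_div_vecNorm (h.sound.1 q (hA q)), fun c => ?_⟩
  have hc : c ∈ σ.D := by
    by_contra hc
    have h2 := h.stable h.r c hc
    have : I.free σ c = ∅ := Finset.sdiff_eq_empty_iff_subset.2 fun q _ => hA q
    simp [this] at h2
  exact (I.clause c).mulVec_proj_productState ((I.clause c).pairing_div (fun q => vecNorm (σ.φ q))
    (h.sound.2 h.r c hc σ.φ fun _ _ => rfl))

theorem wp_solve (hN : I.size ≤ N) (hocc : ∀ q, I.occurrences q ≤ 2) :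
    Wp N .solve I.encode fun u =>
      (u.Accepts ∧ (∀ q : Fin n, IsState (u.output q)) ∧
        I.SatisfiedBy (productState fun q : Fin n => u.output q)) ∨
      (u.Rejects ∧ ¬ I.Satisfiable) := by
  have hn : n ≤ N := (Nat.le_add_right _ _).trans (I.n_add_m_le_size.trans hN)
  have hsound : I.Sound (I.propagate I.start) :=
    Instance.propagate_induction (fun _ _ h => h.step)
      ⟨fun q hq => by simp [Instance.start] at hq, fun _ c hc => by simp [Instance.start] at hc⟩
  have hforced : I.Forced (I.propagate I.start) :=
    Instance.propagate_induction (fun _ _ h => h.step)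
      fun ψ _ => ⟨fun q hq => by simp [Instance.start] at hq, rfl⟩
  refine Wp.seq ((wp_prepare hN).mono fun s₀ _ ⟨h₀, l₀, v₀⟩ => Wp.seq ((wp_propagate hN h₀).mono
    fun s₁ F₁ h₁ => Wp.ite (fun hb => ?_) fun hb => Wp.skip (Or.inr ⟨?_, ?_⟩)))
  · have hgood : I.Good (I.propagate I.start) :=
      ⟨hsound, Instance.stable_propagate _, h₁.r ▸ hb⟩
    refine Wp.seq (Wp.mono (Q := fun u => ∃ σ, Represents I σ u ∧ I.Good σ ∧ ∀ q, q ∈ σ.A) ?_ ?_)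
    · refine Wp.forTo (n := n)
        (fun j u => ∃ σ, Represents I σ u ∧ I.Good σ ∧ ∀ q : Fin n, (q : ℕ) < j → q ∈ σ.A)
        (by decide) hn ?_ ?_ ⟨_, h₁, hgood, fun q hq => absurd hq (Nat.not_lt_zero _)⟩ ?_ ?_
      · intro u F
        simp [F.nat 0 (by decide), h₁.loaded.n]
      · rintro j u v ⟨σ, h, h'⟩
        exact ⟨σ, h.congr (by simp) (by simp), h'⟩
      · rintro j u hj F hk ⟨σ, h, hσ, hA⟩
        have hlen : u.nat 18 0 = n + I.m := by
          rw [F.nat 18 (by decide), F₁.nat 18 (by decide), l₀]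
        refine (wp_choose (q := ⟨j, hj⟩) hN hocc h hσ hlen hk).mono fun w _ ⟨τ, hw, hτ, hsub⟩ =>
          ⟨τ, hw, hτ, fun q hq => ?_⟩
        rcases Nat.lt_succ_iff_lt_or_eq.1 hq with hq | hq
        · exact hsub (Finset.mem_insert_of_mem (hA q hq))
        · have : q = ⟨j, hj⟩ := Fin.ext hq
          exact hsub (this ▸ Finset.mem_insert_self _ _)
      · rintro u _ ⟨σ, h, hσ, hA⟩
        exact ⟨σ, h, hσ, fun q => hA q q.isLt⟩
    · rintro s₂ _ ⟨σ, h₂, hσ, hA⟩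
      refine Wp.seq ((wp_normalise hn h₂.loaded.n).mono fun s₃ _ h₃ => Wp.setNat (Or.inl ?_))
      have hout : ∀ q : Fin n, (s₃.writeNat 3 ((NExp.lit 0).eval s₃) ((NExp.lit 1).eval s₃)).output q
          = fun b => σ.φ q b / vecNorm (σ.φ q) := by
        intro q
        rw [← h₂.φ q (hA q)]
        exact h₃ q
      refine ⟨by simp [Memory.Accepts], fun q => ?_, ?_⟩
      · rw [hout]
        exact isState_div_vecNorm (hσ.sound.1 q (hA q))
      · simp only [hout]
        exact hσ.satisfiedBy hA
  · rw [Memory.Rejects, F₁.nat 3 rfl, v₀]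
  · rintro ⟨ψ, hψ⟩
    exact hb (h₁.r.trans (hforced ψ hψ).2)

end

end BoundedQSAT

end

theorem mainTheorem2 :
    ∃ (A : BoundedQSAT.Program) (p : Polynomial ℕ),
      ∀ (k n : ℕ) (I : BoundedQSAT.Instance k n), (∀ q : Fin n, I.occurrences q ≤ 2) →
        ∃ (t : ℕ) (s : BoundedQSAT.Memory),
          BoundedQSAT.Runs A I.encode t s ∧
          t ≤ p.eval I.size ∧
          (I.Satisfiable →
            s.Accepts ∧
            (∀ q : Fin n, BoundedQSAT.IsState (s.output q)) ∧
            I.SatisfiedBy (BoundedQSAT.productState fun q : Fin n => s.output q)) ∧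
          (¬ I.Satisfiable → s.Rejects) := by
  refine ⟨.solve, BoundedQSAT.Program.solve.timePoly, fun k n I hocc => ?_⟩
  obtain ⟨t, s, hr, ht, h⟩ := BoundedQSAT.wp_solve (le_refl I.size) hocc
  refine ⟨t, s, hr, ht, fun hsat => ?_, fun hsat => ?_⟩
  · exact h.elim id fun h => absurd hsat h.2
  · exact h.elim (fun h => absurd ⟨_, h.2.2⟩ hsat) fun h => h.1
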